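/- Let $\mathcal X$ be a Polish space, let $(\Omega,\mathcal F,(\mathcal F_t)_{t\ge 0})$ be a filtered measurable space, let $X_t$ be an adapted càdlàg $\mathcal X$-valued process on it, and let $(P^x)_{x\in\mathcal X}$ be probability measures on $(\Omega,\mathcal F)$ under which $X$ is a time-homogeneous Markov family with transition probability kernels $p_t$: $X_0$ has law $\delta_x$ under $P^x$, the map $x\mapsto P^x(F)$ is universally measurable for every $F\in\mathcal F$, and $P^x(X_{t+s}\in B\mid\mathcal F_s)=p_t(X_s,B)$ $P^x$-a.s. for all $s,t\ge0$ and Borel $B$. Let $(\widetilde P^x)_{x\in\mathcal X}$ be further probability measures on $(\Omega,\mathcal F)$ such that $X_0$ has law $\delta_x$ under $\widetilde P^x$ and $x\mapsto\widetilde P^x(F)$ is universally measurable for every $F\in\mathcal F$ (no Markov property is assumed). For probability measures $\mu,\widetilde\mu$ on $\mathcal X$ put $P^\mu=\int P^x\,\mu(dx)$ and $\widetilde P^{\widetilde\mu}=\int\widetilde P^x\,\widetilde\mu(dx)$; a subscript $T$ denotes restriction to $\mathcal F_T$. Let $\mu^*$ be a probability measure that is invariant for every $p_t$, let $\mathcal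 P_t[g](x)=\int g(y)\,p_t(x,dy)$ be the Markov semigroup on the real Hilbert space $L^2(\mu^*)$, with inner product $\langle\cdot,\cdot\rangle$, and let $A$, with domain $D(A)$, be its generator. Suppose that $A$ is self-adjoint and that for some $\alpha>0$ the Poincaré inequality $$\operatorname{Var}_{\mu^*}(g)\le-\alpha\,\langle A[g],g\rangle\qquad\text{for all } g\in D(A)$$ holds. Let $f:\mathcal X\to\mathbb R$ be bounded and measurable, and put $\mu^*[f]=\int f\,d\mu^*$ and $\widehat f=f-\mu^*[f]$. Then $L\widehat f=\int_0^\infty\mathcal P_t[\widehat f]\,dt$ converges absolutely in $L^2(\mu^*)$. For $c\in\mathbb R$ let $$\sigma^2(f)=2\langle L\widehat f,\widehat f\rangle,\qquad M^\pm=\alpha\,\|(f-\mu^*[f])^\pm\|_{L^\infty(\mu^*)},$$ $$\Lambda(c)=\sup\Big\{\langle A[g],g\rangle+\int c\,\widehat f\,g^2\,d\mu^*:\ g\in D(A),\ \|g\|_{L^2(\mu^*)}=1\Big\}.$$ For every probability measure $\widetilde\mu$ on $\mathcal X$ and every $T>0$, let $\eta=\frac1T R(\widetilde P^{\widetilde\mu}_T\,\|\,P^{\mu^*}_T)\in[0,\infty]$,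 where $R$ denotes relative entropy. Then, for each choice of the sign, $$\pm\Big(\widetilde E^{\widetilde\mu}\Big[\frac1T\int_0^Tf(X_t)\,dt\Big]-\mu^*[f]\Big)\ \le\ \inf_{c>0}\frac{\Lambda(\pm c)+\eta}{c},$$ and, if $\eta<\infty$, $$\inf_{c>0}\frac{\Lambda(\pm c)+\eta}{c}\ \le\ \sqrt{2\sigma^2(f)\,\eta}+M^\pm\eta.$$ -/

import Mathlib

open MeasureTheory ProbabilityTheory Filter Topology
open scoped NNReal ENNReal RealInnerProductSpace

noncomputable section

namespace MarkovUQ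

/-! ### Markov families -/

/-- A function on a measurable space is universally measurable if it is measurable with respect to
the completion of every probability measure. -/
def UniversallyMeasurable {S β : Type*} [MeasurableSpace S] [MeasurableSpace β] (g : S → β) :
    Prop :=
  ∀ μ : Measure S, IsProbabilityMeasure μ → NullMeasurable g μ

/-- Every path is right-continuous and has left limits. -/
def IsCadlag {S Ω : Type*} [TopologicalSpace S] (X : ℝ≥0 → Ω → S) : Prop :=
  ∀ ω t, ContinuousWithinAt (fun s => X s ω) (Set.Ici t) t ∧
    ∃ l, Tendsto (fun s => X s ω) (𝓝[<] t) (𝓝 l)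

/-- A family `P x` of probability measures on path space, such that `X 0` has law `δ_x` under `P x`
and `x ↦ P x F` is universally measurable for every measurable `F`. No Markov property. -/
structure IsStartedFamily {S Ω : Type*} [MeasurableSpace S] [MeasurableSpace Ω]
    (X : ℝ≥0 → Ω → S) (P : S → Measure Ω) : Prop where
  isProbabilityMeasure : ∀ x, IsProbabilityMeasure (P x)
  map_zero : ∀ x, (P x).map (X 0) = Measure.dirac x
  universallyMeasurable : ∀ F : Set Ω, MeasurableSet F → UniversallyMeasurable fun x => P x F

/-- `(Ω, 𝓕, X, P)` is a time homogeneous càdlàg Markov family with transition probabilities `p`.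
(The Chapman-Kolmogorov equations and `p 0 x = δ_x` follow from these conditions.) -/
structure IsMarkovFamily {S Ω : Type*} [TopologicalSpace S] [MeasurableSpace S]
    {mΩ : MeasurableSpace Ω} (𝓕 : Filtration ℝ≥0 mΩ) (X : ℝ≥0 → Ω → S)
    (p : ℝ≥0 → Kernel S S) (P : S → Measure Ω) : Prop extends IsStartedFamily X P where
  adapted : ∀ t, Measurable[𝓕 t] (X t)
  cadlag : IsCadlag X
  markov : ∀ (x : S) (s t : ℝ≥0) (B : Set S), MeasurableSet B →
    (P x)[(X (t + s) ⁻¹' B).indicator (fun _ => (1 : ℝ)) | 𝓕 s]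
      =ᵐ[P x] fun ω => (p t (X s ω)).real B

/-- The mixture `P^μ(F) = ∫ P^x(F) μ(dx)`. -/
def mixture {S Ω : Type*} [MeasurableSpace S] [MeasurableSpace Ω] (P : S → Measure Ω)
    (hP : ∀ F : Set Ω, MeasurableSet F → UniversallyMeasurable fun x => P x F)
    (μ : Measure S) [hμ : IsProbabilityMeasure μ] : Measure Ω :=
  Measure.ofMeasurable (fun F _ => ∫⁻ x, P x F ∂μ) (by simp) (by
    intro F hF hd
    rw [← lintegral_tsum fun i => (hP (F i) (hF i) μ hμ).aemeasurable]
    exact lintegral_congr fun x => measure_iUnion hd hF)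

theorem mixture_apply {S Ω : Type*} [MeasurableSpace S] [MeasurableSpace Ω] (P : S → Measure Ω)
    (hP : ∀ F : Set Ω, MeasurableSet F → UniversallyMeasurable fun x => P x F)
    (μ : Measure S) [IsProbabilityMeasure μ] {F : Set Ω} (hF : MeasurableSet F) :
    mixture P hP μ F = ∫⁻ x, P x F ∂μ :=
  Measure.ofMeasurable_apply F hF

/-! ### The Markov semigroup on `L²(μ)` and its generator -/

section Transition

variable {S : Type*} [MeasurableSpace S]

theorem lintegral_enorm_integral_sq_le (k : Kernel S S) [IsMarkovKernel k] {μ : Measure S}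
    (h : k.Invariant μ) {g : S → ℝ} (hg : StronglyMeasurable g) :
    ∫⁻ x, ‖∫ y, g y ∂(k x)‖ₑ ^ (2 : ℝ) ∂μ ≤ ∫⁻ x, ‖g x‖ₑ ^ (2 : ℝ) ∂μ := by
  have hm : Measurable fun x => ‖g x‖ₑ ^ (2 : ℝ) := hg.enorm.pow_const _
  conv_rhs => rw [← h.def, Measure.lintegral_bind k.aemeasurable hm.aemeasurable]
  refine lintegral_mono fun x => ?_
  have h1 : eLpNorm g 1 (k x) ≤ eLpNorm g 2 (k x) :=
    eLpNorm_le_eLpNorm_of_exponent_le (by norm_num) hg.aestronglyMeasurable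
  rw [eLpNorm_one_eq_lintegral_enorm, eLpNorm_eq_lintegral_rpow_enorm_toReal (by simp) (by simp)]
    at h1
  calc ‖∫ y, g y ∂(k x)‖ₑ ^ (2 : ℝ) ≤ (∫⁻ y, ‖g y‖ₑ ∂(k x)) ^ (2 : ℝ) := by
        gcongr; exact enorm_integral_le_lintegral_enorm _
    _ ≤ ((∫⁻ y, ‖g y‖ₑ ^ (2 : ℝ) ∂(k x)) ^ (1 / (2 : ℝ))) ^ (2 : ℝ) := by
        gcongr; simpa using h1
    _ = _ := by rw [← ENNReal.rpow_mul]; norm_num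

theorem eLpNorm_integral_le (k : Kernel S S) [IsMarkovKernel k] {μ : Measure S}
    (h : k.Invariant μ) {g : S → ℝ} (hg : StronglyMeasurable g) :
    eLpNorm (fun x => ∫ y, g y ∂(k x)) 2 μ ≤ eLpNorm g 2 μ := by
  rw [eLpNorm_eq_lintegral_rpow_enorm_toReal (by simp) (by simp),
    eLpNorm_eq_lintegral_rpow_enorm_toReal (by simp) (by simp)]
  exact ENNReal.rpow_le_rpow (by exact_mod_cast lintegral_enorm_integral_sq_le k h hg)
    (by positivity)

theorem memLp_integral (k : Kernel S S) [IsMarkovKernel k] {μ : Measure S}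
    (h : k.Invariant μ) (g : Lp ℝ 2 μ) : MemLp (fun x => ∫ y, g y ∂(k x)) 2 μ :=
  ⟨(Lp.stronglyMeasurable g).integral_kernel.aestronglyMeasurable,
    (eLpNorm_integral_le k h (Lp.stronglyMeasurable g)).trans_lt (Lp.memLp g).2⟩

theorem ae_ae_of_invariant (k : Kernel S S) {μ : Measure S} (h : k.Invariant μ) {q : S → Prop}
    (hq : ∀ᵐ x ∂μ, q x) : ∀ᵐ x ∂μ, ∀ᵐ y ∂(k x), q y := by
  rw [← h.def] at hq
  exact Measure.ae_ae_of_ae_bind k.aemeasurable hq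

theorem ae_integrable_of_invariant (k : Kernel S S) {μ : Measure S} [IsFiniteMeasure μ]
    [IsMarkovKernel k] (h : k.Invariant μ) (g : Lp ℝ 2 μ) :
    ∀ᵐ x ∂μ, Integrable g (k x) := by
  have hi : Integrable g (μ.bind k) := by
    rw [h.def]; exact (Lp.memLp g).integrable (by norm_num)
  exact Measure.ae_integrable_of_integrable_comp hi

/-- The transition operator `g ↦ (x ↦ ∫ g(y) k(x, dy))` on the real Hilbert space `L²(μ)`, where
`μ` is invariant for `k`. -/
def transitionOp (k : Kernel S S) [IsMarkovKernel k] (μ : Measure S) [IsProbabilityMeasure μ]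
    (h : k.Invariant μ) : Lp ℝ 2 μ →L[ℝ] Lp ℝ 2 μ :=
  LinearMap.mkContinuous
    { toFun := fun g => (memLp_integral k h g).toLp (fun x => ∫ y, g y ∂(k x))
      map_add' := fun g g' => by
        rw [← MemLp.toLp_add, MemLp.toLp_eq_toLp_iff]
        filter_upwards [ae_ae_of_invariant k h (Lp.coeFn_add g g'),
          ae_integrable_of_invariant k h g, ae_integrable_of_invariant k h g'] with x hx h1 h2
        rw [integral_congr_ae hx]
        exact integral_add h1 h2
      map_smul' := fun c g => by
        rw [RingHom.id_apply, ← MemLp.toLp_const_smul, MemLp.toLp_eq_toLp_iff]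
        filter_upwards [ae_ae_of_invariant k h (Lp.coeFn_smul c g)] with x hx
        rw [integral_congr_ae hx]
        exact integral_smul c _ }
    1 (fun g => by
      rw [one_mul]
      change ‖(memLp_integral k h g).toLp _‖ ≤ ‖g‖
      rw [Lp.norm_toLp, Lp.norm_def]
      exact ENNReal.toReal_mono (Lp.memLp g).2.ne
        (eLpNorm_integral_le k h (Lp.stronglyMeasurable g)))

/-- The Markov semigroup `𝒫_t` of `p` on `L²(μ)`. -/
def semigroup (p : ℝ≥0 → Kernel S S) [∀ t, IsMarkovKernel (p t)] (μ : Measure S)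
    [IsProbabilityMeasure μ] (h : ∀ t, (p t).Invariant μ) (t : ℝ≥0) :
    Lp ℝ 2 μ →L[ℝ] Lp ℝ 2 μ :=
  transitionOp (p t) μ (h t)

end Transition

/-- The generator of a family of operators `Q t`, `t ≥ 0`: the unbounded operator
`A g = lim_{t ↓ 0} (Q t g - g) / t`, with domain the set of those `g` for which the limit exists. -/
def generator {H : Type*} [NormedAddCommGroup H] [NormedSpace ℝ H] (Q : ℝ≥0 → H →L[ℝ] H) :
    H →ₗ.[ℝ] H where
  domain :=
    { carrier := {g | ∃ a, Tendsto (fun t : ℝ≥0 => (t : ℝ)⁻¹ • (Q t g - g)) (𝓝[>] 0) (𝓝 a)}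
      zero_mem' := ⟨0, by simp⟩
      add_mem' := by
        rintro g g' ⟨a, ha⟩ ⟨a', ha'⟩
        refine ⟨a + a', (ha.add ha').congr fun t => ?_⟩
        rw [map_add, ← smul_add]
        congr 1
        abel
      smul_mem' := by
        rintro c g ⟨a, ha⟩
        refine ⟨c • a, (ha.const_smul c).congr fun t => ?_⟩
        rw [map_smul, ← smul_sub, smul_comm] }
  toFun :=
    { toFun := fun g => g.2.choose
      map_add' := fun g g' => by
        refine tendsto_nhds_unique (g + g').2.choose_spec
          ((g.2.choose_spec.add g'.2.choose_spec).congr fun t => ?_)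
        rw [Submodule.coe_add, map_add, ← smul_add]
        congr 1
        abel
      map_smul' := fun c g => by
        refine tendsto_nhds_unique (c • g).2.choose_spec
          ((g.2.choose_spec.const_smul c).congr fun t => ?_)
        rw [Submodule.coe_smul, map_smul, ← smul_sub, smul_comm] }

section Variance

variable {S : Type*} [MeasurableSpace S] {μ : Measure S} [IsProbabilityMeasure μ]

/-- The Poincaré inequality `Var_μ(g) ≤ -α ⟨A g, g⟩` for all `g ∈ D(A)`. -/
def Poincare (A : Lp ℝ 2 μ →ₗ.[ℝ] Lp ℝ 2 μ) (α : ℝ) : Prop :=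
  ∀ g : A.domain, Var[((g : Lp ℝ 2 μ) : S → ℝ); μ] ≤ -α * ⟪A g, (g : Lp ℝ 2 μ)⟫

/-- The Poisson operator `L g = ∫_0^∞ Q_t g dt` (a Bochner integral in `L²(μ)`). -/
def poisson (Q : ℝ≥0 → Lp ℝ 2 μ →L[ℝ] Lp ℝ 2 μ) (g : Lp ℝ 2 μ) : Lp ℝ 2 μ :=
  ∫ t in Set.Ioi (0 : ℝ), Q t.toNNReal g

/-- The centering `g - μ[g]` of `g ∈ L²(μ)`. -/
def center (g : Lp ℝ 2 μ) : Lp ℝ 2 μ :=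
  g - Lp.const 2 μ (∫ x, g x ∂μ)

/-- The asymptotic variance `σ²(g) = 2 ⟨L (g - μ[g]), g - μ[g]⟩`. -/
def asympVar (Q : ℝ≥0 → Lp ℝ 2 μ →L[ℝ] Lp ℝ 2 μ) (g : Lp ℝ 2 μ) : ℝ :=
  2 * ⟪poisson Q (center g), center g⟫

/-- `κ(V) = sup {⟨A g, g⟩ + ∫ V g² dμ : g ∈ D(A), ‖g‖ = 1}`. -/
def kappa (A : Lp ℝ 2 μ →ₗ.[ℝ] Lp ℝ 2 μ) (V : S → ℝ) : EReal :=
  ⨆ g : A.domain, ⨆ _ : ‖(g : Lp ℝ 2 μ)‖ = 1,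
    ((⟪A g, (g : Lp ℝ 2 μ)⟫ + ∫ x, V x * ((g : Lp ℝ 2 μ) x) ^ 2 ∂μ : ℝ) : EReal)

theorem memLp_of_bdd {f : S → ℝ} (hf : Measurable f) (hb : ∃ C, ∀ x, |f x| ≤ C) : MemLp f 2 μ :=
  MemLp.of_bound hf.aestronglyMeasurable hb.choose (ae_of_all _ hb.choose_spec)

end Variance

/-! ### The quantities in the bound -/

/-- `Ξ^±(Λ, η) = inf_{c > 0} (Λ(± c) + η) / c`, where the sign is `s = 1` or `s = -1`. -/
def Xi (s : ℝ) (Λ : ℝ → EReal) (η : EReal) : EReal :=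
  ⨅ c : ℝ, ⨅ _ : 0 < c, (Λ (s * c) + η) / (c : EReal)

/-- `(1/T) R(Q|_{𝓕_T} ‖ P|_{𝓕_T})`, the relative entropy up to time `T`, per unit time. -/
def entropyRate {Ω : Type*} {mΩ : MeasurableSpace Ω} (𝓕 : Filtration ℝ≥0 mΩ) (T : ℝ≥0)
    (Q P : Measure Ω) : ℝ≥0∞ :=
  InformationTheory.klDiv (Q.trim (𝓕.le T)) (P.trim (𝓕.le T)) / T

/-- The time average `(1/T) ∫_0^T f(X_t) dt`. -/
def timeAverage {S Ω : Type*} (f : S → ℝ) (X : ℝ≥0 → Ω → S) (T : ℝ≥0) (ω : Ω) : ℝ :=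
  (T : ℝ)⁻¹ * ∫ t in (0 : ℝ)..T, f (X t.toNNReal ω)

/-- `‖(± (f - μ[f]))⁺‖_∞ = ‖(f - μ[f])^±‖_∞`, the norm being that of `L^∞(μ)` and the sign being
`s = 1` or `s = -1`. -/
def supNormPart {S : Type*} [MeasurableSpace S] (s : ℝ) (f : S → ℝ) (μ : Measure S) : ℝ :=
  (eLpNorm (fun x => max (s * (f x - ∫ y, f y ∂μ)) 0) ∞ μ).toReal

end MarkovUQ

end

/-! For `c > 0` put `V = ±c (f - μ[f])`. The Gibbs variational principle
`integral_le_klDiv_add_log`, applied on `𝓕 T`, bounds the mean of `∫_0^T V(X_t) dt` under the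
alternative law by the relative entropy plus the logarithm of the exponential moment under the
stationary law. Only the latter law has to be Markov. There the Feynman-Kac bound
`integral_exp_pathIntegral_le` gives at most `exp (T Λ(±c))`, and division by `c T` yields the first
inequality.

For the Feynman-Kac bound, let `u t` be the conditional expectation of `exp (∫_0^t V(X_s) ds)` given
`X t`. It starts at `1` and, the semigroup being symmetric, solves `u' = (A + V) u`. An energy
estimate gives `‖u T‖ ≤ exp (T Λ)`, and the exponential moment is `⟪u T, 1⟫`. Since `u t` need not
lie in `D(A)`, the equation is used in the form `u (t + h) - Q_h (u t) = h V u t + o(h)`, and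
`norm_le_of_tendsto` estimates the smoothed curve `R (u t)`, where the time average `R` of the
semigroup (`averageOp`) maps into `D(A)`. Strong continuity comes from the density of `D(A)`; it
also makes `s ↦ V(X_s)` continuous in `L²`, although `V` is only measurable.

The second inequality is a Bernstein bound, `inner_generator_add_le`. Write a unit vector of `D(A)`
as `a + h` with `h` of mean zero, and let `E = -⟪A h, h⟫`. By the Poincaré inequality the term
quadratic in `h` is at most `c M E`. Since `A L(f - μ[f]) = -(f - μ[f])`, the Cauchy-Schwarz
inequality for the form of `-A` bounds the cross term by `2 c √(σ² E / 2)`. Maximizing over `E`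
gives `Λ(±c) ≤ c² σ² / (2 (1 - c M))` when `c M < 1`. The choice `c = 1 / (M + r)` turns the
objective into `σ² / (2 r) + η r + M η`, and the infimum over `r > 0` is the claimed bound. -/

noncomputable section

namespace MarkovUQ

/-! ### Strongly continuous contraction semigroups -/

section Semigroup

variable {H : Type*} [NormedAddCommGroup H] [InnerProductSpace ℝ H]

/-- A strongly continuous semigroup of contractions. -/
structure IsContractionSemigroup (Q : ℝ≥0 → H →L[ℝ] H) : Prop where
  zero_apply : ∀ x, Q 0 x = x
  add_apply : ∀ s t x, Q (s + t) x = Q s (Q t x)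
  norm_apply_le : ∀ t x, ‖Q t x‖ ≤ ‖x‖
  tendsto_zero : ∀ x, Tendsto (fun t => Q t x) (𝓝[>] 0) (𝓝 x)

theorem tendsto_toNNReal_nhdsGT_zero : Tendsto Real.toNNReal (𝓝[>] 0) (𝓝[>] 0) := by
  refine tendsto_nhdsWithin_iff.2 ⟨?_, ?_⟩
  · have := (continuous_real_toNNReal.tendsto 0).mono_left (nhdsWithin_le_nhds (s := Set.Ioi 0))
    simpa using this
  · filter_upwards [self_mem_nhdsWithin] with t ht
    simpa using ht

theorem tendsto_coe_nhdsGT_zero : Tendsto ((↑) : ℝ≥0 → ℝ) (𝓝[>] 0) (𝓝[>] 0) := by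
  refine tendsto_nhdsWithin_iff.2 ⟨?_, ?_⟩
  · have := (NNReal.continuous_coe.tendsto 0).mono_left (nhdsWithin_le_nhds (s := Set.Ioi 0))
    simpa using this
  · filter_upwards [self_mem_nhdsWithin] with t ht
    simpa using ht

theorem tendsto_generator (Q : ℝ≥0 → H →L[ℝ] H) (g : (generator Q).domain) :
    Tendsto (fun t : ℝ≥0 => (t : ℝ)⁻¹ • (Q t g - g)) (𝓝[>] 0) (𝓝 (generator Q g)) :=
  g.2.choose_spec

theorem tendsto_generator_real (Q : ℝ≥0 → H →L[ℝ] H) (g : (generator Q).domain) :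
    Tendsto (fun t : ℝ => t⁻¹ • (Q t.toNNReal g - g)) (𝓝[>] 0) (𝓝 (generator Q g)) := by
  refine ((tendsto_generator Q g).comp tendsto_toNNReal_nhdsGT_zero).congr' ?_
  filter_upwards [self_mem_nhdsWithin] with t ht
  simp [Real.coe_toNNReal t (le_of_lt ht)]

theorem exists_generator_eq {Q : ℝ≥0 → H →L[ℝ] H} {x a : H}
    (h : Tendsto (fun t : ℝ => t⁻¹ • (Q t.toNNReal x - x)) (𝓝[>] 0) (𝓝 a)) :
    ∃ g : (generator Q).domain, (g : H) = x ∧ generator Q g = a := by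
  have h' : Tendsto (fun t : ℝ≥0 => (t : ℝ)⁻¹ • (Q t x - x)) (𝓝[>] 0) (𝓝 a) := by
    refine (h.comp tendsto_coe_nhdsGT_zero).congr fun t => ?_
    simp
  exact ⟨⟨x, a, h'⟩, rfl, tendsto_nhds_unique (tendsto_generator Q ⟨x, a, h'⟩) h'⟩

/-- On the domain, `Q t g - g` is `t` times a convergent quotient; contractivity carries the limit
to the closure. Strong continuity thus follows from the density that self-adjointness includes. -/
theorem tendsto_zero_of_dense {Q : ℝ≥0 → H →L[ℝ] H} (hQ : ∀ t x, ‖Q t x‖ ≤ ‖x‖)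
    (hd : Dense ((generator Q).domain : Set H)) (x : H) :
    Tendsto (fun t => Q t x) (𝓝[>] 0) (𝓝 x) := by
  rw [Metric.tendsto_nhds]
  intro ε hε
  obtain ⟨g, hg, hxg⟩ := hd.exists_dist_lt x (ε := ε / 3) (by positivity)
  have h1 : Tendsto (fun t : ℝ≥0 => (t : ℝ) • ((t : ℝ)⁻¹ • (Q t g - g))) (𝓝[>] 0)
      (𝓝 ((0 : ℝ) • generator Q ⟨g, hg⟩)) :=
    Tendsto.smul (tendsto_coe_nhdsGT_zero.mono_right nhdsWithin_le_nhds)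
      (tendsto_generator Q ⟨g, hg⟩)
  rw [zero_smul, Metric.tendsto_nhds] at h1
  filter_upwards [h1 (ε / 3) (by positivity), self_mem_nhdsWithin] with t ht h0
  rw [smul_inv_smul₀ (by exact_mod_cast (ne_of_gt h0)), dist_zero_right] at ht
  rw [dist_eq_norm] at hxg ⊢
  have h2 : ‖Q t (x - g)‖ ≤ ‖x - g‖ := hQ t _
  calc ‖Q t x - x‖ = ‖Q t (x - g) + (Q t g - g) - (x - g)‖ := by
        rw [map_sub]; congr 1; abel
    _ ≤ ‖Q t (x - g)‖ + ‖Q t g - g‖ + ‖x - g‖ :=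
        (norm_sub_le _ _).trans (add_le_add_left (norm_add_le _ _) _)
    _ < ε := by linarith

theorem inner_comm_of_isSelfAdjoint [CompleteSpace H] {A : H →ₗ.[ℝ] H} (hsa : IsSelfAdjoint A)
    (g g' : A.domain) : ⟪A g, (g' : H)⟫ = ⟪(g : H), A g'⟫ := by
  have h := LinearPMap.adjoint_isFormalAdjoint (T := A) hsa.dense_domain
  rw [LinearPMap.isSelfAdjoint_def.1 hsa] at h
  exact h g g'

namespace IsContractionSemigroup

variable {Q : ℝ≥0 → H →L[ℝ] H}

theorem commute (hQ : IsContractionSemigroup Q) (s t : ℝ≥0) (x : H) :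
    Q s (Q t x) = Q t (Q s x) := by
  rw [← hQ.add_apply, ← hQ.add_apply, add_comm]

theorem norm_sub_le_of_le (hQ : IsContractionSemigroup Q) (x : H) {s t : ℝ≥0} (hst : s ≤ t) :
    ‖Q t x - Q s x‖ ≤ ‖Q (t - s) x - x‖ := by
  have h : Q t x - Q s x = Q s (Q (t - s) x - x) := by
    rw [map_sub, ← hQ.add_apply, add_tsub_cancel_of_le hst]
  rw [h]
  exact hQ.norm_apply_le _ _

theorem continuous_apply (hQ : IsContractionSemigroup Q) (x : H) : Continuous fun t => Q t x := by
  rw [Metric.continuous_iff]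
  intro t ε hε
  have h := Metric.tendsto_nhds.1 (hQ.tendsto_zero x) ε hε
  rw [eventually_nhdsWithin_iff, Metric.eventually_nhds_iff] at h
  obtain ⟨δ, hδ, h⟩ := h
  have key : ∀ a b : ℝ≥0, a ≤ b → dist b a < δ → ‖Q b x - Q a x‖ < ε := by
    intro a b hab hd
    refine (hQ.norm_sub_le_of_le x hab).trans_lt ?_
    rcases eq_or_lt_of_le hab with rfl | hlt
    · simpa [hQ.zero_apply] using hε
    · rw [← dist_eq_norm]
      refine h ?_ (tsub_pos_of_lt hlt)
      rw [NNReal.dist_eq] at hd ⊢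
      rwa [NNReal.coe_sub hab, NNReal.coe_zero, sub_zero]
  refine ⟨δ, hδ, fun s hs => ?_⟩
  rw [dist_eq_norm]
  rcases le_total s t with hst | hst
  · rw [norm_sub_rev]; exact key s t hst (by rwa [dist_comm])
  · exact key t s hst hs

theorem continuous_real (hQ : IsContractionSemigroup Q) (x : H) :
    Continuous fun t : ℝ => Q t.toNNReal x :=
  (hQ.continuous_apply x).comp continuous_real_toNNReal

theorem tendsto_apply (hQ : IsContractionSemigroup Q) {ι : Type*} {l : Filter ι} {τ : ι → ℝ≥0}
    {y : ι → H} {t : ℝ≥0} {x : H} (hτ : Tendsto τ l (𝓝 t)) (hy : Tendsto y l (𝓝 x)) :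
    Tendsto (fun i => Q (τ i) (y i)) l (𝓝 (Q t x)) := by
  have h1 : Tendsto (fun i => Q (τ i) (y i - x)) l (𝓝 0) := by
    refine squeeze_zero_norm (fun i => hQ.norm_apply_le _ _) ?_
    simpa using (hy.sub_const x).norm
  have h2 := h1.add (((hQ.continuous_apply x).tendsto t).comp hτ)
  simpa using h2

theorem exists_generator_apply (hQ : IsContractionSemigroup Q) (t : ℝ≥0)
    (g : (generator Q).domain) :
    ∃ g' : (generator Q).domain, (g' : H) = Q t g ∧ generator Q g' = Q t (generator Q g) := by
  refine exists_generator_eq ?_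
  refine (((Q t).continuous.tendsto _).comp (tendsto_generator_real Q g)).congr fun s => ?_
  simp [hQ.commute t]

theorem hasDerivWithinAt_Ici (hQ : IsContractionSemigroup Q) (g : (generator Q).domain)
    {t : ℝ} (ht : 0 ≤ t) :
    HasDerivWithinAt (fun s : ℝ => Q s.toNNReal g) (Q t.toNNReal (generator Q g)) (Set.Ici t) t := by
  rw [hasDerivWithinAt_iff_tendsto_slope, Set.Ici_sdiff_left]
  have h0 : Tendsto (fun s => s - t) (𝓝[>] t) (𝓝[>] 0) := by
    refine tendsto_nhdsWithin_iff.2 ⟨?_, ?_⟩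
    · have : Tendsto (fun s => s - t) (𝓝 t) (𝓝 (t - t)) := (continuous_id.sub continuous_const).tendsto t
      rw [sub_self] at this
      exact this.mono_left nhdsWithin_le_nhds
    · filter_upwards [self_mem_nhdsWithin] with s hs
      simpa using hs
  refine (((Q t.toNNReal).continuous.tendsto _).comp
    ((tendsto_generator_real Q g).comp h0)).congr' ?_
  filter_upwards [self_mem_nhdsWithin] with s hs
  have hs' : t ≤ s := le_of_lt hs
  simp only [Function.comp, map_smul, map_sub, slope_def_module, ← hQ.add_apply]
  rw [← Real.toNNReal_add ht (by linarith), add_sub_cancel]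

/-- The left quotient at `t` is `Q s` applied to the initial quotient of length `t - s`. Operator
and argument move together, so the joint continuity in `tendsto_apply` is needed. -/
theorem hasDerivWithinAt_Iic (hQ : IsContractionSemigroup Q) (g : (generator Q).domain)
    {t : ℝ} (ht : 0 < t) :
    HasDerivWithinAt (fun s : ℝ => Q s.toNNReal g) (Q t.toNNReal (generator Q g)) (Set.Iic t) t := by
  rw [hasDerivWithinAt_iff_tendsto_slope, Set.Iic_sdiff_right]
  have h0 : Tendsto (fun s => t - s) (𝓝[<] t) (𝓝[>] 0) := by
    refine tendsto_nhdsWithin_iff.2 ⟨?_, ?_⟩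
    · have : Tendsto (fun s => t - s) (𝓝 t) (𝓝 (t - t)) := (continuous_const.sub continuous_id).tendsto t
      rw [sub_self] at this
      exact this.mono_left nhdsWithin_le_nhds
    · filter_upwards [self_mem_nhdsWithin] with s hs
      simpa using hs
  have h1 : Tendsto Real.toNNReal (𝓝[<] t) (𝓝 t.toNNReal) :=
    (continuous_real_toNNReal.tendsto t).mono_left nhdsWithin_le_nhds
  refine (hQ.tendsto_apply h1 ((tendsto_generator_real Q g).comp h0)).congr' ?_
  filter_upwards [self_mem_nhdsWithin, mem_nhdsWithin_of_mem_nhds (Ioi_mem_nhds ht)] with s hs h0s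
  have hs' : s ≤ t := le_of_lt hs
  simp only [Function.comp, map_smul, map_sub, slope_def_module, ← hQ.add_apply]
  rw [← Real.toNNReal_add (le_of_lt h0s) (by linarith), add_sub_cancel, ← neg_sub t s, inv_neg,
    neg_smul, ← smul_neg, neg_sub]

/-- A contraction semigroup with symmetric generator is symmetric. -/
theorem inner_apply_comm [CompleteSpace H] (hQ : IsContractionSemigroup Q)
    (hsa : IsSelfAdjoint (generator Q)) (t : ℝ≥0) (x y : H) : ⟪Q t x, y⟫ = ⟪x, Q t y⟫ := by
  have hd := hsa.dense_domain
  have hA := inner_comm_of_isSelfAdjoint hsa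
  -- The function `s ↦ ⟪Q s g, Q (t - s) g'⟫` takes the two sides as its values at `s = t` and `s =
  -- 0`. Its right derivative vanishes because the two contributions of the symmetric generator
  -- cancel.
  have hdom : ∀ g g' : (generator Q).domain, ⟪Q t g, (g' : H)⟫ = ⟪(g : H), Q t g'⟫ := by
    intro g g'
    have hc : ContinuousOn (fun s : ℝ => ⟪Q s.toNNReal g, Q (t - s).toNNReal g'⟫)
        (Set.Icc 0 (t : ℝ)) :=
      ((hQ.continuous_real g).inner
        ((hQ.continuous_real g').comp (continuous_const.sub continuous_id))).continuousOn
    have := constant_of_has_deriv_right_zero hc (fun s hs => ?_) t ⟨t.2, le_rfl⟩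
    · simpa [hQ.zero_apply] using this
    · have hlt : 0 < (t : ℝ) - s := sub_pos.2 hs.2
      have h1 := hQ.hasDerivWithinAt_Ici g hs.1
      have h2 : HasDerivWithinAt (fun s : ℝ => Q (t - s).toNNReal g')
          ((-1 : ℝ) • Q (t - s).toNNReal (generator Q g')) (Set.Ici s) s := by
        have h3 : HasDerivWithinAt (fun s : ℝ => (t : ℝ) - s) (-1) (Set.Ici s) s :=
          (hasDerivAt_id s).hasDerivWithinAt.const_sub _
        refine HasDerivWithinAt.scomp s (hQ.hasDerivWithinAt_Iic g' hlt) h3 ?_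
        intro r hr
        simp only [Set.mem_Iic, Set.mem_Ici] at hr ⊢
        linarith
      have h4 := h1.inner ℝ h2
      obtain ⟨k, hk, hk'⟩ := hQ.exists_generator_apply s.toNNReal g
      obtain ⟨k', hk1, hk1'⟩ := hQ.exists_generator_apply (t - s).toNNReal g'
      rw [← hk, ← hk', ← hk1, ← hk1', hA, inner_smul_right] at h4
      rw [neg_one_mul, neg_add_cancel] at h4
      exact h4
  have hcl : ∀ g : (generator Q).domain, ∀ y, ⟪Q t g, y⟫ = ⟪(g : H), Q t y⟫ := by
    intro g y
    refine isClosed_property hd.denseRange_val (p := fun y => ⟪Q t g, y⟫ = ⟪(g : H), Q t y⟫) ?_ ?_ y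
    · exact isClosed_eq (by fun_prop) (by fun_prop)
    · exact fun z => hdom g z
  refine isClosed_property hd.denseRange_val (p := fun x => ⟪Q t x, y⟫ = ⟪x, Q t y⟫) ?_ ?_ x
  · exact isClosed_eq (by fun_prop) (by fun_prop)
  · exact fun z => hcl z y

end IsContractionSemigroup

end Semigroup

/-! ### Time averages of a contraction semigroup -/

section Semigroup

variable {H : Type*} [NormedAddCommGroup H] [InnerProductSpace ℝ H]

namespace IsContractionSemigroup

variable {Q : ℝ≥0 → H →L[ℝ] H}

/-- The time average `ε⁻¹ ∫_0^ε Q_s ds`, as an operator. -/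
def averageOp (hQ : IsContractionSemigroup Q) (ε : ℝ) (hε : 0 < ε) : H →L[ℝ] H :=
  LinearMap.mkContinuous
    { toFun := fun x => ε⁻¹ • ∫ s in (0 : ℝ)..ε, Q s.toNNReal x
      map_add' := fun x y => by
        simp only [map_add]
        rw [intervalIntegral.integral_add ((hQ.continuous_real x).intervalIntegrable _ _)
          ((hQ.continuous_real y).intervalIntegrable _ _), smul_add]
      map_smul' := fun c x => by
        simp only [map_smul, RingHom.id_apply]
        rw [intervalIntegral.integral_smul, smul_comm] }
    1 (fun x => by
      simp only [LinearMap.coe_mk, AddHom.coe_mk, norm_smul, one_mul]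
      have h := intervalIntegral.norm_integral_le_of_norm_le_const (a := 0) (b := ε)
        (f := fun s : ℝ => Q s.toNNReal x) (C := ‖x‖) fun s _ => hQ.norm_apply_le _ _
      rw [sub_zero, abs_of_pos hε] at h
      rw [norm_inv, Real.norm_of_nonneg hε.le, inv_mul_le_iff₀ hε]
      linarith)

variable {ε : ℝ} {hε : 0 < ε}

theorem averageOp_apply (hQ : IsContractionSemigroup Q) (x : H) :
    hQ.averageOp ε hε x = ε⁻¹ • ∫ s in (0 : ℝ)..ε, Q s.toNNReal x := rfl

theorem norm_averageOp_apply_le (hQ : IsContractionSemigroup Q) (x : H) :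
    ‖hQ.averageOp ε hε x‖ ≤ ‖x‖ := by
  have := (hQ.averageOp ε hε).le_of_opNorm_le
    (LinearMap.mkContinuous_norm_le _ zero_le_one _) x
  simpa using this

variable [CompleteSpace H]

theorem apply_integral (hQ : IsContractionSemigroup Q) (x : H) {h τ : ℝ} (hh : 0 ≤ h)
    (hτ : 0 ≤ τ) :
    Q h.toNNReal (∫ s in (0 : ℝ)..τ, Q s.toNNReal x)
      = (∫ s in (0 : ℝ)..(τ + h), Q s.toNNReal x) - ∫ s in (0 : ℝ)..h, Q s.toNNReal x := by
  have hi : ∀ a b : ℝ, IntervalIntegrable (fun s : ℝ => Q s.toNNReal x) volume a b :=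
    fun a b => (hQ.continuous_real x).intervalIntegrable a b
  rw [← ContinuousLinearMap.intervalIntegral_comp_comm _ (hi 0 τ),
    intervalIntegral.integral_interval_sub_left (hi _ _) (hi _ _)]
  have h1 := intervalIntegral.integral_comp_add_right (fun s : ℝ => Q s.toNNReal x) h (a := 0)
    (b := τ)
  rw [zero_add] at h1
  rw [← h1]
  refine intervalIntegral.integral_congr fun s hs => ?_
  rw [Set.uIcc_of_le hτ] at hs
  rw [← hQ.add_apply, add_comm s, Real.toNNReal_add hh hs.1]

theorem tendsto_integral (hQ : IsContractionSemigroup Q) (x : H) (τ : ℝ) :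
    Tendsto (fun h : ℝ => h⁻¹ • ((∫ s in (0 : ℝ)..(τ + h), Q s.toNNReal x)
      - ∫ s in (0 : ℝ)..τ, Q s.toNNReal x)) (𝓝[>] 0) (𝓝 (Q τ.toNNReal x)) := by
  have h1 : HasDerivAt (fun t : ℝ => ∫ s in (0 : ℝ)..t, Q s.toNNReal x) (Q τ.toNNReal x) τ :=
    (hQ.continuous_real x).integral_hasStrictDerivAt 0 τ |>.hasDerivAt
  exact h1.tendsto_slope_zero_right

/-- By `apply_integral` the difference quotient is the slope of the primitive of `s ↦ Q s x` at `τ`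
minus its slope at `0`. Hence time averages of arbitrary vectors lie in the domain. -/
theorem exists_generator_integral (hQ : IsContractionSemigroup Q) (x : H) {τ : ℝ} (hτ : 0 ≤ τ) :
    ∃ g : (generator Q).domain, (g : H) = ∫ s in (0 : ℝ)..τ, Q s.toNNReal x ∧
      generator Q g = Q τ.toNNReal x - x := by
  refine exists_generator_eq ?_
  have h1 := (hQ.tendsto_integral x τ).sub (hQ.tendsto_integral x 0)
  rw [Real.toNNReal_zero, hQ.zero_apply] at h1
  refine h1.congr' ?_
  filter_upwards [self_mem_nhdsWithin] with h hh
  rw [hQ.apply_integral x (le_of_lt hh) hτ, ← smul_sub, intervalIntegral.integral_same, zero_add,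
    sub_zero]
  congr 1
  abel

theorem apply_averageOp (hQ : IsContractionSemigroup Q) (t : ℝ≥0) (x : H) :
    Q t (hQ.averageOp ε hε x) = hQ.averageOp ε hε (Q t x) := by
  rw [averageOp_apply, averageOp_apply, map_smul, ← ContinuousLinearMap.intervalIntegral_comp_comm _
    ((hQ.continuous_real x).intervalIntegrable _ _)]
  simp only [hQ.commute t]

theorem exists_generator_averageOp (hQ : IsContractionSemigroup Q) (x : H) :
    ∃ g : (generator Q).domain, (g : H) = hQ.averageOp ε hε x := by
  obtain ⟨g, hg, -⟩ := hQ.exists_generator_integral x hε.le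
  exact ⟨ε⁻¹ • g, by rw [averageOp_apply, ← hg]; rfl⟩

theorem tendsto_averageOp (hQ : IsContractionSemigroup Q) (x : H) {δ : ℝ} (hδ : 0 < δ) :
    ∃ ε₀ > 0, ∀ ε (hε : 0 < ε), ε < ε₀ → ‖hQ.averageOp ε hε x - x‖ ≤ δ := by
  have h := hQ.tendsto_integral x 0
  rw [Real.toNNReal_zero, hQ.zero_apply, Metric.tendsto_nhds] at h
  have h1 := h δ hδ
  rw [eventually_nhdsWithin_iff, Metric.eventually_nhds_iff] at h1
  obtain ⟨ε₀, hε₀, h1⟩ := h1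
  refine ⟨ε₀, hε₀, fun ε hε hlt => ?_⟩
  have h2 := h1 (y := ε) (by simpa [abs_of_pos hε] using hlt) hε
  rw [dist_eq_norm, intervalIntegral.integral_same, zero_add, sub_zero] at h2
  exact h2.le

/-- Pointwise convergence of contractions is uniform on compact sets. The energy estimate needs one
`ε` that serves along a whole trajectory. -/
theorem exists_averageOp_sub_le_of_isCompact (hQ : IsContractionSemigroup Q) {K : Set H}
    (hK : IsCompact K) {δ : ℝ} (hδ : 0 < δ) :
    ∃ ε₀ > 0, ∀ ε (hε : 0 < ε), ε < ε₀ → ∀ x ∈ K, ‖hQ.averageOp ε hε x - x‖ ≤ δ := by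
  refine hK.induction_on (p := fun K => ∃ ε₀ > 0, ∀ ε (hε : 0 < ε), ε < ε₀ →
    ∀ x ∈ K, ‖hQ.averageOp ε hε x - x‖ ≤ δ) ⟨1, one_pos, by simp⟩ ?_ ?_ ?_
  · rintro s t hst ⟨ε₀, h0, h⟩
    exact ⟨ε₀, h0, fun ε hε hlt x hx => h ε hε hlt x (hst hx)⟩
  · rintro s t ⟨ε₀, h0, h⟩ ⟨ε₁, h1, h'⟩
    refine ⟨min ε₀ ε₁, lt_min h0 h1, fun ε hε hlt x hx => ?_⟩
    rcases hx with hx | hx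
    · exact h ε hε (hlt.trans_le (min_le_left _ _)) x hx
    · exact h' ε hε (hlt.trans_le (min_le_right _ _)) x hx
  · intro x _
    obtain ⟨ε₀, h0, h⟩ := hQ.tendsto_averageOp x (δ := δ / 3) (by positivity)
    refine ⟨Metric.ball x (δ / 3), mem_nhdsWithin_of_mem_nhds (Metric.ball_mem_nhds _ (by positivity)),
      ε₀, h0, fun ε hε hlt y hy => ?_⟩
    have h1 := h ε hε hlt
    have h2 : ‖hQ.averageOp ε hε (y - x)‖ ≤ ‖y - x‖ := hQ.norm_averageOp_apply_le _
    rw [mem_ball_iff_norm] at hy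
    calc ‖hQ.averageOp ε hε y - y‖
        = ‖hQ.averageOp ε hε (y - x) + (hQ.averageOp ε hε x - x) - (y - x)‖ := by
          rw [map_sub]; congr 1; abel
      _ ≤ ‖hQ.averageOp ε hε (y - x)‖ + ‖hQ.averageOp ε hε x - x‖ + ‖y - x‖ :=
        (norm_sub_le _ _).trans (add_le_add_left (norm_add_le _ _) _)
      _ ≤ δ := by linarith

/-! ### Exponential decay and the Poisson equation -/

variable {e : H} {α : ℝ}

theorem inner_left_apply (hQ : IsContractionSemigroup Q) (hsa : IsSelfAdjoint (generator Q))
    (he : ∀ t, Q t e = e) (t : ℝ≥0) (x : H) : ⟪e, Q t x⟫ = ⟪e, x⟫ := by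
  rw [← hQ.inner_apply_comm hsa, he]

/-- The flow preserves orthogonality to `e`, so the Poincaré inequality applies at all times and the
right derivative of `‖Q s g‖ ^ 2` is at most `-(2 / α)` times the function. Grönwall's inequality
and a square root give the rate `1 / α`. -/
theorem norm_apply_le_exp_of_mem_domain (hQ : IsContractionSemigroup Q)
    (hsa : IsSelfAdjoint (generator Q)) (he : ∀ t, Q t e = e) (hα : 0 < α)
    (hp : ∀ g : (generator Q).domain, ⟪e, (g : H)⟫ = 0 →
      ‖(g : H)‖ ^ 2 ≤ -α * ⟪generator Q g, (g : H)⟫)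
    (g : (generator Q).domain) (hg : ⟪e, (g : H)⟫ = 0) {t : ℝ} (ht : 0 ≤ t) :
    ‖Q t.toNNReal g‖ ≤ Real.exp (-t / α) * ‖(g : H)‖ := by
  have hder : ∀ s : ℝ, 0 ≤ s → HasDerivWithinAt (fun s : ℝ => ‖Q s.toNNReal g‖ ^ 2)
      (2 * ⟪Q s.toNNReal g, Q s.toNNReal (generator Q g)⟫) (Set.Ici s) s :=
    fun s hs => (hQ.hasDerivWithinAt_Ici g hs).norm_sq
  have hc : Continuous fun s : ℝ => ‖Q s.toNNReal g‖ ^ 2 := (hQ.continuous_real g).norm.pow 2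
  have hG := le_gronwallBound_of_liminf_deriv_right_le (δ := ‖(g : H)‖ ^ 2) (K := -(2 / α)) (ε := 0)
    (hc.continuousOn (s := Set.Icc 0 t))
    (fun s hs r hr => (hder s hs.1).liminf_right_slope_le hr)
    (by simp [hQ.zero_apply]) (fun s hs => ?_) t ⟨ht, le_rfl⟩
  · rw [gronwallBound_ε0, sub_zero] at hG
    refine (pow_le_pow_iff_left₀ (norm_nonneg _) (by positivity) two_ne_zero).1 (hG.trans_eq ?_)
    rw [mul_pow, ← Real.exp_nat_mul, mul_comm]
    congr 2
    push_cast
    ring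
  · obtain ⟨k, hk, hk'⟩ := hQ.exists_generator_apply s.toNNReal g
    have h1 := hp k (by rw [hk, hQ.inner_left_apply hsa he, hg])
    rw [hk', hk, real_inner_comm] at h1
    rw [add_zero, neg_mul, div_mul_eq_mul_div, ← neg_div, le_div_iff₀ hα]
    linarith

theorem inner_averageOp (hQ : IsContractionSemigroup Q) (hsa : IsSelfAdjoint (generator Q))
    (he : ∀ t, Q t e = e) (x : H) : ⟪e, hQ.averageOp ε hε x⟫ = ⟪e, x⟫ := by
  have h1 := ContinuousLinearMap.intervalIntegral_comp_comm (innerSL ℝ e)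
    ((hQ.continuous_real x).intervalIntegrable (μ := volume) 0 ε)
  simp only [innerSL_apply_apply, hQ.inner_left_apply hsa he] at h1
  rw [averageOp_apply, inner_smul_right, ← h1]
  simp [hε.ne']

theorem norm_apply_le_exp (hQ : IsContractionSemigroup Q)
    (hsa : IsSelfAdjoint (generator Q)) (he : ∀ t, Q t e = e) (hα : 0 < α)
    (hp : ∀ g : (generator Q).domain, ⟪e, (g : H)⟫ = 0 →
      ‖(g : H)‖ ^ 2 ≤ -α * ⟪generator Q g, (g : H)⟫)
    {x : H} (hx : ⟪e, x⟫ = 0) {t : ℝ} (ht : 0 ≤ t) :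
    ‖Q t.toNNReal x‖ ≤ Real.exp (-t / α) * ‖x‖ := by
  refine le_of_forall_pos_le_add fun δ hδ => ?_
  obtain ⟨ε₀, h0, h⟩ := hQ.tendsto_averageOp x hδ
  have hε : 0 < ε₀ / 2 := by positivity
  have h1 := h (ε₀ / 2) hε (by linarith)
  obtain ⟨g, hg⟩ := hQ.exists_generator_averageOp (hε := hε) x
  have h2 := hQ.norm_apply_le_exp_of_mem_domain hsa he hα hp g
    (by rw [hg, hQ.inner_averageOp hsa he, hx]) ht
  have h3 : ‖(g : H)‖ ≤ ‖x‖ := by rw [hg]; exact hQ.norm_averageOp_apply_le x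
  have h4 : ‖Q t.toNNReal (g - x)‖ ≤ δ := (hQ.norm_apply_le _ _).trans (by rwa [hg])
  calc ‖Q t.toNNReal x‖ = ‖Q t.toNNReal g - Q t.toNNReal (g - x)‖ := by rw [map_sub]; simp
    _ ≤ Real.exp (-t / α) * ‖(g : H)‖ + δ := (norm_sub_le _ _).trans (add_le_add h2 h4)
    _ ≤ _ := by gcongr

theorem integrableOn_apply (hQ : IsContractionSemigroup Q)
    (hsa : IsSelfAdjoint (generator Q)) (he : ∀ t, Q t e = e) (hα : 0 < α)
    (hp : ∀ g : (generator Q).domain, ⟪e, (g : H)⟫ = 0 →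
      ‖(g : H)‖ ^ 2 ≤ -α * ⟪generator Q g, (g : H)⟫)
    {x : H} (hx : ⟪e, x⟫ = 0) : IntegrableOn (fun t : ℝ => Q t.toNNReal x) (Set.Ioi 0) := by
  refine Integrable.mono' (g := fun t => Real.exp (-(1 / α) * t) * ‖x‖)
    ((exp_neg_integrableOn_Ioi 0 (by positivity)).mul_const _)
    (hQ.continuous_real x).aestronglyMeasurable ?_
  refine (ae_restrict_iff' measurableSet_Ioi).2 (ae_of_all _ fun t ht => ?_)
  refine (hQ.norm_apply_le_exp hsa he hα hp hx (le_of_lt ht)).trans_eq ?_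
  congr 2
  ring

/-- `∫_0^∞ Q_t x dt` solves the Poisson equation. -/
theorem exists_generator_poisson (hQ : IsContractionSemigroup Q) {x : H}
    (hx : IntegrableOn (fun t : ℝ => Q t.toNNReal x) (Set.Ioi 0)) :
    ∃ g : (generator Q).domain, (g : H) = ∫ t in Set.Ioi (0 : ℝ), Q t.toNNReal x ∧
      generator Q g = -x := by
  refine exists_generator_eq ?_
  have h1 := (hQ.tendsto_integral x 0).neg
  rw [Real.toNNReal_zero, hQ.zero_apply] at h1
  refine h1.congr' ?_
  filter_upwards [self_mem_nhdsWithin] with h hh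
  rw [intervalIntegral.integral_same, zero_add, sub_zero, ← smul_neg]
  congr 1
  -- The operator is applied to the integral over `[0, τ]`, and then `τ → ∞`: the integrals up to
  -- `τ` and up to `τ + h` have the same limit, so only `-∫_0^h` survives.
  have h2 : Tendsto (fun τ : ℝ => ∫ s in (0 : ℝ)..τ, Q s.toNNReal x) atTop
      (𝓝 (∫ t in Set.Ioi (0 : ℝ), Q t.toNNReal x)) :=
    intervalIntegral_tendsto_integral_Ioi 0 hx tendsto_id
  have h3 := ((Q h.toNNReal).continuous.tendsto _).comp h2
  have h4 := (h2.comp (tendsto_atTop_add_const_right atTop h tendsto_id)).sub_const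
    (∫ s in (0 : ℝ)..h, Q s.toNNReal x)
  have h5 := tendsto_nhds_unique h3 (h4.congr' ?_)
  · rw [h5]; abel
  · filter_upwards [eventually_ge_atTop 0] with τ hτ
    exact (hQ.apply_integral x (le_of_lt hh) hτ).symm

end IsContractionSemigroup

end Semigroup

/-! ### Quadratic form bounds and the energy estimate -/

section Semigroup

variable {H : Type*} [NormedAddCommGroup H] [InnerProductSpace ℝ H]

/-- The Cauchy-Schwarz inequality for the form of a nonnegative symmetric operator. -/
theorem inner_sq_le_of_nonneg [CompleteSpace H] {A : H →ₗ.[ℝ] H} (hsa : IsSelfAdjoint A)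
    (hA : ∀ g : A.domain, ⟪A g, (g : H)⟫ ≤ 0) (g k : A.domain) :
    ⟪A g, (k : H)⟫ ^ 2 ≤ ⟪A g, (g : H)⟫ * ⟪A k, (k : H)⟫ := by
  have h : ∀ x : ℝ, 0 ≤ (-⟪A k, (k : H)⟫) * (x * x) + (-2 * ⟪A g, (k : H)⟫) * x
      + (-⟪A g, (g : H)⟫) := by
    intro x
    have h1 := hA (g + x • k)
    have h2 : ⟪A k, (g : H)⟫ = ⟪A g, (k : H)⟫ := by
      rw [inner_comm_of_isSelfAdjoint hsa, real_inner_comm]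
    rw [LinearPMap.map_add, LinearPMap.map_smul, Submodule.coe_add, Submodule.coe_smul] at h1
    simp only [inner_add_left, inner_add_right, real_inner_smul_left, real_inner_smul_right] at h1
    rw [h2] at h1
    linarith
  have := discrim_le_zero h
  rw [discrim] at this
  linarith

namespace IsContractionSemigroup

variable {Q : ℝ≥0 → H →L[ℝ] H} {e : H} {α : ℝ}

theorem generator_eq_zero (hQ : ∀ t, Q t e = e) :
    ∃ g : (generator Q).domain, (g : H) = e ∧ generator Q g = 0 :=
  exists_generator_eq (by simp [hQ])

theorem inner_generator_nonpos (hQ : IsContractionSemigroup Q) (g : (generator Q).domain) :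
    ⟪generator Q g, (g : H)⟫ ≤ 0 := by
  refine le_of_tendsto ((tendsto_generator_real Q g).inner tendsto_const_nhds) ?_
  filter_upwards [self_mem_nhdsWithin] with t ht
  rw [real_inner_smul_left, inner_sub_left]
  have h1 : ⟪Q t.toNNReal g, (g : H)⟫ ≤ ‖(g : H)‖ * ‖(g : H)‖ :=
    (real_inner_le_norm _ _).trans (by gcongr; exact hQ.norm_apply_le _ _)
  rw [← real_inner_self_eq_norm_mul_norm] at h1
  exact mul_nonpos_of_nonneg_of_nonpos (inv_nonneg.2 (le_of_lt ht)) (by linarith)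

variable [CompleteSpace H]

/-- A Bernstein type bound on the quadratic form of a perturbation of the generator. -/
theorem inner_generator_add_le (hQ : IsContractionSemigroup Q)
    (hsa : IsSelfAdjoint (generator Q)) (he : ∀ t, Q t e = e) (hen : ‖e‖ = 1) (hα : 0 < α)
    (hp : ∀ g : (generator Q).domain, ⟪e, (g : H)⟫ = 0 →
      ‖(g : H)‖ ^ 2 ≤ -α * ⟪generator Q g, (g : H)⟫)
    {B : H →L[ℝ] H} (hB : ∀ x y, ⟪B x, y⟫ = ⟪x, B y⟫) {m : ℝ} (hm : 0 ≤ m)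
    (hBm : ∀ x, ⟪B x, x⟫ ≤ m * ‖x‖ ^ 2) (hBe : ⟪e, B e⟫ = 0) {c : ℝ} (hc : 0 < c)
    (hcm : c * (α * m) < 1) (g : (generator Q).domain) (hg : ‖(g : H)‖ = 1) :
    ⟪generator Q g, (g : H)⟫ + c * ⟪B g, (g : H)⟫
      ≤ c ^ 2 * (2 * ⟪∫ t in Set.Ioi (0 : ℝ), Q t.toNNReal (B e), B e⟫)
        / (2 * (1 - c * (α * m))) := by
  have hneg : ∀ g : (generator Q).domain, ⟪generator Q g, (g : H)⟫ ≤ 0 := hQ.inner_generator_nonpos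
  obtain ⟨k, hk, hAk⟩ := generator_eq_zero he
  obtain ⟨l, hl, hAl⟩ := hQ.exists_generator_poisson (hQ.integrableOn_apply hsa he hα hp hBe)
  -- Split `g = a e + h` with `h` orthogonal to `e`. As `e` is in the kernel of the generator, the
  -- energy sees only `h`; as `⟪e, B e⟫ = 0`, no term in `a ^ 2` arises from `B`.
  set a := ⟪e, (g : H)⟫ with ha
  set h : (generator Q).domain := g - a • k with hh
  have hh' : (h : H) = g - a • e := by rw [hh, Submodule.coe_sub, Submodule.coe_smul, hk]
  have hAh : generator Q h = generator Q g := by rw [hh, LinearPMap.map_sub, LinearPMap.map_smul, hAk, smul_zero, sub_zero]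
  have hee : ⟪e, e⟫ = 1 := by rw [real_inner_self_eq_norm_sq, hen, one_pow]
  have heh : ⟪e, (h : H)⟫ = 0 := by
    rw [hh', inner_sub_right, real_inner_smul_right, hee, mul_one, sub_self]
  have hE : ⟪generator Q g, (g : H)⟫ = ⟪generator Q h, (h : H)⟫ := by
    have : ⟪generator Q g, e⟫ = 0 := by
      rw [← hk, inner_comm_of_isSelfAdjoint hsa, hAk, inner_zero_right]
    rw [hAh, hh', inner_sub_right, real_inner_smul_right, this, mul_zero, sub_zero]
  have hBg : ⟪B g, (g : H)⟫ = 2 * a * ⟪B e, (h : H)⟫ + ⟪B h, (h : H)⟫ := by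
    have h1 : (g : H) = a • e + h := by rw [hh']; abel
    have h2 : ⟪B h, e⟫ = ⟪B e, (h : H)⟫ := by rw [hB, real_inner_comm]
    have h3 : ⟪B e, e⟫ = 0 := by rw [hB, hBe]
    rw [h1, map_add, map_smul]
    simp only [inner_add_left, inner_add_right, real_inner_smul_left, real_inner_smul_right]
    rw [h2, h3]
    ring
  have ha1 : |a| ≤ 1 := by
    have := abs_real_inner_le_norm e (g : H)
    rwa [hen, hg, one_mul] at this
  set E := -⟪generator Q h, (h : H)⟫ with hEdef
  have hE0 : 0 ≤ E := neg_nonneg.2 (hneg h)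
  -- The Poincaré inequality converts the quadratic term into a multiple of the energy, to be
  -- absorbed because `c * (α * m) < 1`.
  have h1 : ⟪B h, (h : H)⟫ ≤ α * m * E := by
    have h2 := hp h heh
    calc ⟪B h, (h : H)⟫ ≤ m * ‖(h : H)‖ ^ 2 := hBm h
      _ ≤ m * (α * E) := by
        gcongr
        rw [hEdef]
        linarith
      _ = _ := by ring
  set σ := ⟪∫ t in Set.Ioi (0 : ℝ), Q t.toNNReal (B e), B e⟫ with hσ
  -- Cauchy-Schwarz for the energy form, applied to `h` and the Poisson solution `l`, for which
  -- `generator Q l = -B e`. The energy of `l` is exactly `σ`.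
  have hcs : ⟪B e, (h : H)⟫ ^ 2 ≤ σ * E := by
    have h2 := inner_sq_le_of_nonneg hsa hneg l h
    rw [hAl, inner_neg_left, hl, inner_neg_left, neg_sq,
      show ⟪B e, _⟫ = σ from real_inner_comm _ _] at h2
    rw [hEdef]
    linarith
  rw [hE, hBg, show ⟪generator Q h, (h : H)⟫ = -E by rw [hEdef, neg_neg]]
  set b := ⟪B e, (h : H)⟫ with hb
  have hd : 0 < 1 - c * (α * m) := by linarith
  have hab : a * b ≤ |b| := by
    calc a * b ≤ |a| * |b| := by rw [← abs_mul]; exact le_abs_self _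
      _ ≤ 1 * |b| := by gcongr
      _ = |b| := one_mul _
  have hσ0 : 0 ≤ σ := by
    rw [hσ, ← hl, real_inner_comm, ← neg_neg (B e), ← hAl, inner_neg_left]
    exact neg_nonneg.2 (hneg l)
  rw [le_div_iff₀ (by positivity)]
  set d := 1 - c * (α * m) with hddef
  have h5 : -E + c * (2 * a * b + ⟪B h, (h : H)⟫) ≤ -(d * E) + 2 * c * |b| := by
    have : c * ⟪B h, (h : H)⟫ ≤ c * (α * m * E) := by gcongr
    have h6 : c * (a * b) ≤ c * |b| := by gcongr
    rw [hddef]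
    linarith
  calc _ ≤ (-(d * E) + 2 * c * |b|) * (2 * d) := by gcongr
    _ ≤ c ^ 2 * (2 * σ) := by
      -- The arithmetic-geometric mean inequality for `c ^ 2 * σ` and `d ^ 2 * E`, in squared form
      -- to avoid square roots.
      have h7 : (2 * c * |b| * d) ^ 2 ≤ (c ^ 2 * σ + d ^ 2 * E) ^ 2 := by
        have h8 : (2 * c * |b| * d) ^ 2 = 4 * c ^ 2 * d ^ 2 * b ^ 2 := by
          rw [mul_pow, mul_pow, mul_pow, sq_abs]; ring
        have h9 : 4 * c ^ 2 * d ^ 2 * b ^ 2 ≤ 4 * c ^ 2 * d ^ 2 * (σ * E) := by gcongr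
        nlinarith [sq_nonneg (c ^ 2 * σ - d ^ 2 * E)]
      have h10 := (abs_le_of_sq_le_sq' h7 (by positivity)).2
      nlinarith

/-- The energy estimate for `u' = (A + B) u`, where `A` is the generator of a contraction
semigroup `Q`, in a weak form that needs no regularity of `u`. -/
theorem norm_le_of_tendsto (hQ : IsContractionSemigroup Q) {B : H →L[ℝ] H} {κ : ℝ}
    (hκ : ∀ g : (generator Q).domain,
      ⟪generator Q g, (g : H)⟫ + ⟪B g, (g : H)⟫ ≤ κ * ‖(g : H)‖ ^ 2)
    {u : ℝ → H} {T : ℝ} (hT : 0 ≤ T) (hu : ContinuousOn u (Set.Icc 0 T))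
    (hu' : ∀ t ∈ Set.Ico 0 T,
      Tendsto (fun h : ℝ => h⁻¹ • (u (t + h) - Q h.toNNReal (u t))) (𝓝[>] 0) (𝓝 (B (u t)))) :
    ‖u T‖ ≤ ‖u 0‖ * Real.exp (κ * T) := by
  have hK : IsCompact (u '' Set.Icc 0 T) := isCompact_Icc.image_of_continuousOn hu
  obtain ⟨M, hM⟩ := hK.isBounded.exists_norm_le
  have hM' : ∀ t ∈ Set.Icc 0 T, ‖u t‖ ≤ M := fun t ht => hM _ (Set.mem_image_of_mem _ ht)
  have hM0 : 0 ≤ M := (norm_nonneg _).trans (hM' 0 ⟨le_rfl, hT⟩)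
  -- Since `u t` may lie outside the domain, the curve `R (u t)` is differentiated instead. `R`
  -- commutes with the semigroup but not with `B`; the commutator costs at most `δ + ‖B‖ * δ` and
  -- enters Grönwall's inequality as the inhomogeneous term.
  have key : ∀ δ > 0, ∃ v : H, ‖v - u T‖ ≤ δ ∧
      ‖v‖ ^ 2 ≤ gronwallBound (‖u 0‖ ^ 2) (2 * κ) (2 * ((δ + ‖B‖ * δ) * M)) T := by
    intro δ hδ
    obtain ⟨ε₀, h0, h1⟩ := hQ.exists_averageOp_sub_le_of_isCompact hK hδ
    obtain ⟨ε₁, h0', h1'⟩ := hQ.exists_averageOp_sub_le_of_isCompact (hK.image B.continuous) hδ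
    set ε := min ε₀ ε₁ / 2 with hεdef
    have hmin : 0 < min ε₀ ε₁ := lt_min h0 h0'
    have hε : 0 < ε := by positivity
    have hlt : ε < min ε₀ ε₁ := half_lt_self hmin
    set R := hQ.averageOp ε hε with hR
    have hR1 : ∀ t ∈ Set.Icc 0 T, ‖R (u t) - u t‖ ≤ δ := fun t ht =>
      h1 ε hε (hlt.trans_le (min_le_left _ _)) _ (Set.mem_image_of_mem _ ht)
    have hR2 : ∀ t ∈ Set.Icc 0 T, ‖R (B (u t)) - B (u t)‖ ≤ δ := fun t ht =>
      h1' ε hε (hlt.trans_le (min_le_right _ _)) _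
        (Set.mem_image_of_mem _ (Set.mem_image_of_mem _ ht))
    have hRn : ∀ x, ‖R x‖ ≤ ‖x‖ := fun x => hQ.norm_averageOp_apply_le x
    have hRQ : ∀ t x, Q t (R x) = R (Q t x) := fun t x => hQ.apply_averageOp t x
    refine ⟨R (u T), hR1 T ⟨hT, le_rfl⟩, ?_⟩
    choose g hg using fun t => hQ.exists_generator_averageOp (hε := hε) (u t)
    have hder : ∀ t ∈ Set.Ico 0 T, HasDerivWithinAt (fun s => ‖R (u s)‖ ^ 2)
        (2 * ⟪R (u t), R (B (u t)) + generator Q (g t)⟫) (Set.Ici t) t := by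
      intro t ht
      refine HasDerivWithinAt.norm_sq ?_
      rw [hasDerivWithinAt_iff_tendsto_slope, Set.Ici_sdiff_left]
      have h2 := ((R.continuous.tendsto _).comp (hu' t ht)).add (tendsto_generator_real Q (g t))
      have h3 : Tendsto (fun s => s - t) (𝓝[>] t) (𝓝[>] 0) := by
        refine tendsto_nhdsWithin_iff.2 ⟨?_, ?_⟩
        · have : Tendsto (fun s => s - t) (𝓝 t) (𝓝 (t - t)) :=
            (continuous_id.sub continuous_const).tendsto t
          rw [sub_self] at this
          exact this.mono_left nhdsWithin_le_nhds
        · filter_upwards [self_mem_nhdsWithin] with s hs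
          simpa using hs
      refine (h2.comp h3).congr fun s => ?_
      simp only [Function.comp, map_smul, map_sub, slope_def_module, hg, add_sub_cancel,
        ← hR, hRQ]
      rw [← smul_add]
      congr 1
      abel
    refine (le_gronwallBound_of_liminf_deriv_right_le (a := 0) (b := T)
      (f := fun s => ‖R (u s)‖ ^ 2) (δ := ‖u 0‖ ^ 2) ?_
      (fun s hs r hr => (hder s hs).liminf_right_slope_le hr) ?_ (fun s hs => ?_) T
      ⟨hT, le_rfl⟩).trans_eq (by rw [sub_zero])
    · exact ((R.continuous.comp_continuousOn hu).norm).pow 2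
    · gcongr
      exact hRn _
    · have hs' : s ∈ Set.Icc 0 T := ⟨hs.1, hs.2.le⟩
      have h4 := hκ (g s)
      rw [hg, ← hR] at h4
      have h5 : ⟪R (B (u s)) - B (R (u s)), R (u s)⟫ ≤ (δ + ‖B‖ * δ) * M := by
        refine (real_inner_le_norm _ _).trans ?_
        have h6 : ‖R (B (u s)) - B (R (u s))‖ ≤ δ + ‖B‖ * δ := by
          have h7 : R (B (u s)) - B (R (u s)) = (R (B (u s)) - B (u s)) - B (R (u s) - u s) := by
            rw [map_sub]; abel
          rw [h7]
          refine (norm_sub_le _ _).trans (add_le_add (hR2 s hs') ?_)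
          exact (B.le_opNorm _).trans (by gcongr; exact hR1 s hs')
        gcongr
        exact (hRn _).trans (hM' s hs')
      rw [inner_sub_left] at h5
      rw [real_inner_comm, inner_add_left]
      linarith
  have hsq : ‖u T‖ ^ 2 ≤ gronwallBound (‖u 0‖ ^ 2) (2 * κ) 0 T := by
    choose v hv hv' using fun n : ℕ => key (1 / ((n : ℝ) + 1)) (by positivity)
    have hlim : Tendsto (fun n : ℕ => 1 / ((n : ℝ) + 1)) atTop (𝓝 0) :=
      tendsto_one_div_add_atTop_nhds_zero_nat
    have hvu : Tendsto v atTop (𝓝 (u T)) := by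
      rw [tendsto_iff_norm_sub_tendsto_zero]
      exact squeeze_zero (fun n => norm_nonneg _) hv hlim
    refine le_of_tendsto_of_tendsto (hvu.norm.pow 2) ?_ (Eventually.of_forall hv')
    have h2 : Tendsto (fun n : ℕ => 2 * ((1 / ((n : ℝ) + 1) + ‖B‖ * (1 / ((n : ℝ) + 1))) * M))
        atTop (𝓝 (2 * ((0 + ‖B‖ * 0) * M))) :=
      ((hlim.add (hlim.const_mul _)).mul_const _).const_mul _
    rw [mul_zero, add_zero, zero_mul, mul_zero] at h2
    exact ((gronwallBound_continuous_ε (‖u 0‖ ^ 2) (2 * κ) T).tendsto 0).comp h2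
  rw [gronwallBound_ε0] at hsq
  refine (pow_le_pow_iff_left₀ (norm_nonneg _) (by positivity) two_ne_zero).1 (hsq.trans_eq ?_)
  rw [mul_pow, ← Real.exp_nat_mul]
  congr 2
  push_cast
  ring

end IsContractionSemigroup

end Semigroup

/-! ### Markov processes started from an invariant measure -/

section Mixture

variable {S Ω : Type*} [MeasurableSpace S] [MeasurableSpace Ω] {P : S → Measure Ω}
  (hP : ∀ F : Set Ω, MeasurableSet F → UniversallyMeasurable fun x => P x F)
  (μ : Measure S) [hμ : IsProbabilityMeasure μ]

theorem isProbabilityMeasure_mixture (h : ∀ x, IsProbabilityMeasure (P x)) :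
    IsProbabilityMeasure (mixture P hP μ) :=
  ⟨by simp [mixture_apply]⟩

/-- As `P` is only universally measurable, it need not be a kernel. The induction on `F` therefore
carries a.e. measurability along with the identity, as additivity and monotone convergence require
it. -/
theorem lintegral_mixture {F : Ω → ℝ≥0∞} (hF : Measurable F) :
    AEMeasurable (fun x => ∫⁻ ω, F ω ∂(P x)) μ ∧
      ∫⁻ ω, F ω ∂(mixture P hP μ) = ∫⁻ x, ∫⁻ ω, F ω ∂(P x) ∂μ := by
  refine Measurable.ennreal_induction (motive := fun F => AEMeasurable (fun x => ∫⁻ ω, F ω ∂(P x)) μ ∧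
    ∫⁻ ω, F ω ∂(mixture P hP μ) = ∫⁻ x, ∫⁻ ω, F ω ∂(P x) ∂μ) ?_ ?_ ?_ hF
  · intro c s hs
    have hm : AEMeasurable (fun x => P x s) μ := (hP s hs μ hμ).aemeasurable
    simp only [lintegral_indicator_const hs]
    exact ⟨hm.const_mul _, by rw [lintegral_const_mul'' _ hm, mixture_apply P hP μ hs]⟩
  · intro f g _ hf hg hf' hg'
    simp only [Pi.add_apply, lintegral_add_left hf]
    exact ⟨hf'.1.add hg'.1, by rw [lintegral_add_left' hf'.1, hf'.2, hg'.2]⟩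
  · intro f hf hmono hf'
    simp only [lintegral_iSup hf hmono]
    refine ⟨AEMeasurable.iSup fun n => (hf' n).1, ?_⟩
    rw [lintegral_iSup' (fun n => (hf' n).1)
      (ae_of_all _ fun x => fun m n hmn => lintegral_mono (hmono hmn))]
    exact iSup_congr fun n => (hf' n).2

end Mixture

section Markov

variable {S Ω : Type*} [MeasurableSpace S]
  {mΩ : MeasurableSpace Ω} {𝓕 : Filtration ℝ≥0 mΩ} {X : ℝ≥0 → Ω → S}
  {p : ℝ≥0 → Kernel S S} {P : S → Measure Ω}

/-- `X` is a stationary Markov process under `ρ`, with transition probabilities `p` and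
invariant measure `μ`. -/
structure IsStationaryMarkov (𝓕 : Filtration ℝ≥0 mΩ) (X : ℝ≥0 → Ω → S) (p : ℝ≥0 → Kernel S S)
    (μ : Measure S) (ρ : Measure Ω) : Prop where
  isProbabilityMeasure : IsProbabilityMeasure ρ
  measurable : ∀ t, Measurable[𝓕 t] (X t)
  measurePreserving : ∀ t, MeasurePreserving (X t) ρ μ
  measure_inter : ∀ (s t : ℝ≥0) (F : Set Ω), MeasurableSet[𝓕 s] F → ∀ B, MeasurableSet B →
    ρ (F ∩ X (t + s) ⁻¹' B) = ∫⁻ ω in F, p t (X s ω) B ∂ρ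

namespace IsMarkovFamily

variable [TopologicalSpace S]

theorem measurable (hP : IsMarkovFamily 𝓕 X p P) (t : ℝ≥0) : Measurable (X t) :=
  (hP.adapted t).mono (𝓕.le t) le_rfl

variable [∀ t, IsMarkovKernel (p t)]

/-- An integrated form of the Markov property. Being an identity between integrals over `P x`, it
passes to mixtures over the starting point. -/
theorem measure_inter (hP : IsMarkovFamily 𝓕 X p P) (x : S) (s t : ℝ≥0) {F : Set Ω}
    (hF : MeasurableSet[𝓕 s] F) {B : Set S} (hB : MeasurableSet B) :
    P x (F ∩ X (t + s) ⁻¹' B) = ∫⁻ ω in F, p t (X s ω) B ∂(P x) := by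
  have := hP.isProbabilityMeasure x
  have hXB : MeasurableSet (X (t + s) ⁻¹' B) := hP.measurable _ hB
  have h1 := setIntegral_condExp (μ := P x) (𝓕.le s) (f := (X (t + s) ⁻¹' B).indicator
    (fun _ => (1 : ℝ))) ((integrable_const _).indicator hXB) hF
  have hm : Measurable fun ω => p t (X s ω) B :=
    ((p t).measurable_coe hB).comp (hP.measurable s)
  rw [setIntegral_congr_ae (𝓕.le s _ hF) ((hP.markov x s t B hB).mono fun ω h _ => h),
    integral_indicator_const _ hXB, smul_eq_mul, mul_one, measureReal_restrict_apply hXB] at h1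
  have h2 := ofReal_integral_eq_lintegral_ofReal (μ := (P x).restrict F)
    (f := fun ω => (p t (X s ω)).real B)
    (Integrable.of_bound hm.ennreal_toReal.aestronglyMeasurable 1
      (ae_of_all _ fun ω => by
        rw [Real.norm_of_nonneg measureReal_nonneg]; exact measureReal_le_one))
    (ae_of_all _ fun ω => measureReal_nonneg)
  rw [h1, ofReal_measureReal, Set.inter_comm] at h2
  rw [h2]
  exact lintegral_congr fun ω => ofReal_measureReal

theorem map_eq (hP : IsMarkovFamily 𝓕 X p P) (x : S) (t : ℝ≥0) : (P x).map (X t) = p t x := by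
  ext B hB
  have h := hP.measure_inter x 0 t MeasurableSet.univ hB
  rw [Set.univ_inter, add_zero, Measure.restrict_univ,
    ← lintegral_map (f := fun y => p t y B) ((p t).measurable_coe hB) (hP.measurable 0),
    hP.map_zero, lintegral_dirac' _ ((p t).measurable_coe hB)] at h
  rw [Measure.map_apply (hP.measurable t) hB, h]

/-- The Chapman-Kolmogorov equations. -/
theorem chapman_kolmogorov (hP : IsMarkovFamily 𝓕 X p P) (s t : ℝ≥0) :
    p (s + t) = p t ∘ₖ p s := by
  ext x B hB
  have h := hP.measure_inter x s t MeasurableSet.univ hB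
  rw [Set.univ_inter, Measure.restrict_univ,
    ← lintegral_map (f := fun y => p t y B) ((p t).measurable_coe hB) (hP.measurable s),
    hP.map_eq, ← Measure.map_apply (hP.measurable _) hB, hP.map_eq] at h
  rw [Kernel.comp_apply' _ _ _ hB, ← h, add_comm]

theorem kernel_zero (hP : IsMarkovFamily 𝓕 X p P) (x : S) : p 0 x = Measure.dirac x := by
  rw [← hP.map_eq, hP.map_zero]

theorem isStationaryMarkov (hP : IsMarkovFamily 𝓕 X p P) (μ : Measure S) [IsProbabilityMeasure μ]
    (hμ : ∀ t, (p t).Invariant μ) :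
    IsStationaryMarkov 𝓕 X p μ (mixture P hP.universallyMeasurable μ) where
  isProbabilityMeasure := isProbabilityMeasure_mixture _ μ hP.isProbabilityMeasure
  measurable := hP.adapted
  measurePreserving t := by
    refine ⟨hP.measurable t, ?_⟩
    ext B hB
    rw [Measure.map_apply (hP.measurable t) hB, mixture_apply _ _ _ (hP.measurable t hB)]
    simp only [← Measure.map_apply (hP.measurable t) hB, hP.map_eq]
    conv_rhs => rw [← (hμ t).def, Measure.bind_apply hB (p t).aemeasurable]
  measure_inter s t F hF B hB := by
    have hm : Measurable fun ω => p t (X s ω) B :=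
      ((p t).measurable_coe hB).comp (hP.measurable s)
    rw [mixture_apply _ _ _ ((𝓕.le s _ hF).inter (hP.measurable _ hB)),
      ← lintegral_indicator (𝓕.le s _ hF),
      (lintegral_mixture _ μ (hm.indicator (𝓕.le s _ hF))).2]
    refine lintegral_congr fun x => ?_
    rw [hP.measure_inter x s t hF hB, lintegral_indicator (𝓕.le s _ hF)]

end IsMarkovFamily

variable [∀ t, IsMarkovKernel (p t)]

theorem coeFn_semigroup (μ : Measure S) [IsProbabilityMeasure μ] (hμ : ∀ t, (p t).Invariant μ)
    (t : ℝ≥0) (g : Lp ℝ 2 μ) : semigroup p μ hμ t g =ᵐ[μ] fun x => ∫ y, g y ∂(p t x) :=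
  MemLp.coeFn_toLp (memLp_integral (p t) (hμ t) g)

theorem norm_semigroup_apply_le (μ : Measure S) [IsProbabilityMeasure μ]
    (hμ : ∀ t, (p t).Invariant μ) (t : ℝ≥0) (g : Lp ℝ 2 μ) : ‖semigroup p μ hμ t g‖ ≤ ‖g‖ := by
  change ‖(memLp_integral (p t) (hμ t) g).toLp _‖ ≤ ‖g‖
  rw [Lp.norm_toLp, Lp.norm_def]
  exact ENNReal.toReal_mono (Lp.memLp g).2.ne
    (eLpNorm_integral_le (p t) (hμ t) (Lp.stronglyMeasurable g))

theorem semigroup_const (μ : Measure S) [IsProbabilityMeasure μ]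
    (hμ : ∀ t, (p t).Invariant μ) (t : ℝ≥0) (c : ℝ) :
    semigroup p μ hμ t (Lp.const 2 μ c) = Lp.const 2 μ c := by
  refine Lp.ext ?_
  filter_upwards [coeFn_semigroup μ hμ t (Lp.const 2 μ c), Lp.coeFn_const 2 μ c,
    ae_ae_of_invariant (p t) (hμ t) (Lp.coeFn_const 2 μ c)] with x h1 h2 h3
  rw [h1, h2, integral_congr_ae h3]
  simp

theorem IsMarkovFamily.isContractionSemigroup [TopologicalSpace S] (hP : IsMarkovFamily 𝓕 X p P) (μ : Measure S)
    [IsProbabilityMeasure μ] (hμ : ∀ t, (p t).Invariant μ)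
    (hd : Dense ((generator (semigroup p μ hμ)).domain : Set (Lp ℝ 2 μ))) :
    IsContractionSemigroup (semigroup p μ hμ) where
  zero_apply g := by
    refine Lp.ext ?_
    filter_upwards [coeFn_semigroup μ hμ 0 g] with x hx
    rw [hx, hP.kernel_zero, integral_dirac' _ _ (Lp.stronglyMeasurable g)]
  add_apply s t g := by
    refine Lp.ext ?_
    filter_upwards [coeFn_semigroup μ hμ (s + t) g,
      coeFn_semigroup μ hμ s (semigroup p μ hμ t g),
      ae_ae_of_invariant (p s) (hμ s) (coeFn_semigroup μ hμ t g),
      ae_integrable_of_invariant (p (s + t)) (hμ (s + t)) g] with x h1 h2 h3 h4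
    rw [hP.chapman_kolmogorov] at h4
    rw [h1, h2, integral_congr_ae h3, hP.chapman_kolmogorov, Kernel.integral_comp h4]
  norm_apply_le := norm_semigroup_apply_le μ hμ
  tendsto_zero := tendsto_zero_of_dense (norm_semigroup_apply_le μ hμ) hd

namespace IsStationaryMarkov

variable {μ : Measure S} [IsProbabilityMeasure μ] {ρ : Measure Ω} (hμ : ∀ t, (p t).Invariant μ)

/-- The isometry `g ↦ g(X_t)`. -/
def pullback (h : IsStationaryMarkov 𝓕 X p μ ρ) (t : ℝ≥0) : Lp ℝ 2 μ →ₗᵢ[ℝ] Lp ℝ 2 ρ :=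
  Lp.compMeasurePreservingₗᵢ ℝ (X t) (h.measurePreserving t)

omit [∀ t, IsMarkovKernel (p t)] [IsProbabilityMeasure μ] in
theorem coeFn_pullback (h : IsStationaryMarkov 𝓕 X p μ ρ) (t : ℝ≥0) (g : Lp ℝ 2 μ) :
    h.pullback t g =ᵐ[ρ] fun ω => g (X t ω) :=
  Lp.coeFn_compMeasurePreserving g (h.measurePreserving t)

/-- The Markov property, for a weight `W` that is measurable up to time `s`. -/
theorem inner_pullback_add (h : IsStationaryMarkov 𝓕 X p μ ρ) (s t : ℝ≥0) {W : Ω → ℝ}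
    (hW : StronglyMeasurable[𝓕 s] W) {C : ℝ} (hC : ∀ ω, |W ω| ≤ C) (hW2 : MemLp W 2 ρ)
    (g : Lp ℝ 2 μ) :
    ⟪hW2.toLp W, h.pullback (t + s) g⟫ = ⟪hW2.toLp W, h.pullback s (semigroup p μ hμ t g)⟫ := by
  have := h.isProbabilityMeasure
  -- Both sides are linear and continuous in `g`, so indicators suffice. For these, the Markov
  -- property identifies a conditional expectation given `𝓕 s`, and the bounded `𝓕 s`-measurable
  -- factor `W` is pulled out.
  induction g using Lp.induction (p := 2) ENNReal.ofNat_ne_top with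
  | indicatorConst c hB hμB =>
    rename_i B
    rw [Lp.simpleFunc.coe_indicatorConst]
    have hXm : Measurable (X (t + s)) := (h.measurable _).mono (𝓕.le _) le_rfl
    have hXB : MeasurableSet (X (t + s) ⁻¹' B) := hXm hB
    have hm : Measurable fun ω => p t (X s ω) B :=
      ((p t).measurable_coe hB).comp ((h.measurable _).mono (𝓕.le _) le_rfl)
    have hm' : Measurable[𝓕 s] fun ω => p t (X s ω) B :=
      ((p t).measurable_coe hB).comp (h.measurable s)
    have hI : Integrable (fun ω => (p t (X s ω)).real B) ρ :=
      Integrable.of_bound hm.ennreal_toReal.aestronglyMeasurable 1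
        (ae_of_all _ fun ω => by
          rw [Real.norm_of_nonneg measureReal_nonneg]; exact measureReal_le_one)
    have hInd : Integrable ((X (t + s) ⁻¹' B).indicator (fun _ => (1 : ℝ))) ρ :=
      (integrable_const _).indicator hXB
    have hce : (fun ω => (p t (X s ω)).real B)
        =ᵐ[ρ] ρ[(X (t + s) ⁻¹' B).indicator (fun _ => (1 : ℝ)) | 𝓕 s] := by
      refine ae_eq_condExp_of_forall_setIntegral_eq (𝓕.le s) hInd (fun F _ _ => hI.integrableOn)
        (fun F hF _ => ?_) (hm'.ennreal_toReal.stronglyMeasurable.aestronglyMeasurable)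
      rw [integral_indicator_const _ hXB, smul_eq_mul, mul_one, measureReal_restrict_apply hXB,
        Set.inter_comm, measureReal_def, h.measure_inter s t F hF B hB]
      exact integral_toReal hm.aemeasurable (ae_of_all _ fun ω => measure_lt_top _ _)
    have hpo := condExp_stronglyMeasurable_mul_of_bound (𝓕.le s) hW hInd C (ae_of_all _ hC)
    have e1 : ∫ ω, W ω * (X (t + s) ⁻¹' B).indicator (fun _ => (1 : ℝ)) ω ∂ρ
        = ∫ ω, W ω * (p t (X s ω)).real B ∂ρ := by
      have h1 := integral_condExp (μ := ρ) (𝓕.le s)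
        (f := W * (X (t + s) ⁻¹' B).indicator (fun _ => (1 : ℝ)))
      have h2 : ∫ ω, (W * (X (t + s) ⁻¹' B).indicator (fun _ => (1 : ℝ))) ω ∂ρ
        = ∫ ω, W ω * (X (t + s) ⁻¹' B).indicator (fun _ => (1 : ℝ)) ω ∂ρ := rfl
      rw [← h2, ← h1, integral_congr_ae hpo]
      refine integral_congr_ae (hce.mono fun ω hω => ?_)
      simp only [Pi.mul_apply]
      rw [← hω]
    have e2 : ⟪hW2.toLp W, h.pullback (t + s) (indicatorConstLp 2 hB hμB.ne c)⟫
        = c * ∫ ω, W ω * (X (t + s) ⁻¹' B).indicator (fun _ => (1 : ℝ)) ω ∂ρ := by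
      rw [L2.inner_def, ← integral_const_mul]
      refine integral_congr_ae ?_
      filter_upwards [hW2.coeFn_toLp, h.coeFn_pullback (t + s) (indicatorConstLp 2 hB hμB.ne c),
        (h.measurePreserving (t + s)).quasiMeasurePreserving.ae
          (indicatorConstLp_coeFn (p := 2) (hs := hB) (hμs := hμB.ne) (c := c))] with ω h1 h2 h3
      rw [h1, h2, h3, RCLike.inner_apply, conj_trivial]
      by_cases hω : X (t + s) ω ∈ B
      · rw [Set.indicator_of_mem hω, Set.indicator_of_mem (by exact hω)]; ring
      · rw [Set.indicator_of_notMem hω, Set.indicator_of_notMem (by exact hω)]; ring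
    have e3 : ⟪hW2.toLp W, h.pullback s (semigroup p μ hμ t (indicatorConstLp 2 hB hμB.ne c))⟫
        = c * ∫ ω, W ω * (p t (X s ω)).real B ∂ρ := by
      rw [L2.inner_def, ← integral_const_mul]
      refine integral_congr_ae ?_
      have h4 : semigroup p μ hμ t (indicatorConstLp 2 hB hμB.ne c)
          =ᵐ[μ] fun x => c * (p t x).real B := by
        filter_upwards [coeFn_semigroup μ hμ t (indicatorConstLp 2 hB hμB.ne c),
          ae_ae_of_invariant (p t) (hμ t)
          (indicatorConstLp_coeFn (p := 2) (hs := hB) (hμs := hμB.ne) (c := c))] with x h1 h2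
        rw [h1, integral_congr_ae h2, integral_indicator_const _ hB, smul_eq_mul, mul_comm]
      filter_upwards [hW2.coeFn_toLp,
        h.coeFn_pullback s (semigroup p μ hμ t (indicatorConstLp 2 hB hμB.ne c)),
        (h.measurePreserving s).quasiMeasurePreserving.ae h4] with ω h1 h2 h3
      rw [h1, h2, h3, RCLike.inner_apply, conj_trivial]
      ring
    rw [e2, e3, e1]
  | add hf hg _ hf' hg' =>
    rw [map_add, map_add, map_add, inner_add_right, inner_add_right, hf', hg']
  | isClosed => exact isClosed_eq (by fun_prop) (by fun_prop)

end IsStationaryMarkov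

end Markov

/-! ### Continuity of approximate semigroup trajectories -/

section Semigroup

variable {H : Type*} [NormedAddCommGroup H] [InnerProductSpace ℝ H] {Q : ℝ≥0 → H →L[ℝ] H}

/-- For continuity from the left, a direct use of the hypothesis would require strong continuity at
a moving vector `u s`. Instead both points are compared with the flow from a common earlier time
`a`, fixed near `t`, so strong continuity at the single vector `u a` suffices. -/
theorem IsContractionSemigroup.continuousOn_of_norm_sub_le (hQ : IsContractionSemigroup Q)
    {u : ℝ → H} {T K : ℝ} (hK : 0 ≤ K)
    (hu : ∀ t h, 0 ≤ t → 0 ≤ h → t + h ≤ T → ‖u (t + h) - Q h.toNNReal (u t)‖ ≤ K * h) :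
    ContinuousOn u (Set.Icc 0 T) := by
  have key : ∀ a s t, 0 ≤ a → a ≤ s → s ≤ t → t ≤ T →
      ‖u t - u s‖ ≤ ‖Q (t - s).toNNReal (u a) - u a‖ + 2 * K * (t - a) := by
    intro a s t ha has hst htT
    have h1 := hu a (t - a) ha (by linarith) (by linarith)
    have h2 := hu a (s - a) ha (by linarith) (by linarith)
    rw [add_sub_cancel] at h1 h2
    have h3 : Q (t - a).toNNReal (u a) = Q (s - a).toNNReal (Q (t - s).toNNReal (u a)) := by
      rw [← hQ.add_apply, ← Real.toNNReal_add (by linarith) (by linarith)]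
      congr 2
      ring_nf
    have h4 : ‖Q (s - a).toNNReal (Q (t - s).toNNReal (u a) - u a)‖
        ≤ ‖Q (t - s).toNNReal (u a) - u a‖ := hQ.norm_apply_le _ _
    have h5 : K * (s - a) ≤ K * (t - a) := by gcongr
    calc ‖u t - u s‖ = ‖(u t - Q (t - a).toNNReal (u a))
          + Q (s - a).toNNReal (Q (t - s).toNNReal (u a) - u a)
          - (u s - Q (s - a).toNNReal (u a))‖ := by
          rw [h3, map_sub]; congr 1; abel
      _ ≤ K * (t - a) + ‖Q (t - s).toNNReal (u a) - u a‖ + K * (s - a) :=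
        (norm_sub_le _ _).trans (add_le_add ((norm_add_le _ _).trans (add_le_add h1 h4)) h2)
      _ ≤ _ := by linarith
  intro t ht
  rw [Metric.continuousWithinAt_iff]
  intro ε hε
  set δ := ε / (8 * (K + 1)) with hδ
  have hδ0 : 0 < δ := by positivity
  have hKδ : 2 * K * (2 * δ) ≤ ε / 2 := by
    have h1 : (K + 1) * δ = ε / 8 := by rw [hδ]; field_simp
    linarith
  set a := max 0 (t - δ) with ha
  have hc : Tendsto (fun r : ℝ => Q r.toNNReal (u a)) (𝓝 0) (𝓝 (u a)) := by
    have := (hQ.continuous_real (u a)).tendsto 0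
    rwa [Real.toNNReal_zero, hQ.zero_apply] at this
  obtain ⟨δ', hδ', h⟩ := Metric.tendsto_nhds_nhds.1 hc (ε / 2) (by positivity)
  have ha0 : 0 ≤ a := le_max_left _ _
  have hat : a ≤ t := max_le ht.1 (by linarith)
  have hat' : t - a ≤ δ := by linarith [le_max_right 0 (t - δ)]
  refine ⟨min δ δ', lt_min hδ0 hδ', fun s hs hd => ?_⟩
  rw [Real.dist_eq] at hd
  have hd1 := abs_lt.1 (hd.trans_le (min_le_left _ _))
  have hd2 := hd.trans_le (min_le_right _ _)
  have has : a ≤ s := max_le hs.1 (by linarith)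
  rw [dist_eq_norm]
  rcases le_total s t with hst | hst
  · have h1 := key a s t ha0 has hst ht.2
    have h2 := h (x := t - s) (by rw [Real.dist_eq, sub_zero, abs_sub_comm]; exact hd2)
    rw [dist_eq_norm] at h2
    have h3 : 2 * K * (t - a) ≤ 2 * K * (2 * δ) := by gcongr; linarith
    rw [norm_sub_rev]
    linarith
  · have h1 := key a t s ha0 hat hst hs.2
    have h2 := h (x := s - t) (by rw [Real.dist_eq, sub_zero]; exact hd2)
    rw [dist_eq_norm] at h2
    have h3 : 2 * K * (s - a) ≤ 2 * K * (2 * δ) := by gcongr; linarith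
    linarith

end Semigroup

/-! ### Path integrals -/

section Path

variable {S Ω : Type*} [TopologicalSpace S] [PolishSpace S] [MeasurableSpace S] [BorelSpace S]

/-- Times are rounded up to a grid of mesh `1 / (n + 1)`. For fixed `n` only countably many maps `Y
t` occur, and the grid times approach `t` from the right, where the paths are continuous. -/
theorem measurable_uncurry_of_rightContinuous [MeasurableSpace Ω] {Y : ℝ≥0 → Ω → S}
    (hY : ∀ t, Measurable (Y t))
    (hc : ∀ ω t, ContinuousWithinAt (fun s => Y s ω) (Set.Ici t) t) :
    Measurable (Function.uncurry Y) := by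
  let τ : ℕ → ℝ≥0 → ℝ≥0 := fun n t => ((⌊(n + 1 : ℝ≥0) * t⌋₊ : ℝ≥0) + 1) / (n + 1)
  have hτm : ∀ n, Measurable fun q : ℝ≥0 × Ω => Y (τ n q.1) q.2 := by
    intro n
    have h1 : Measurable fun q : ℕ × Ω => Y (((q.1 : ℝ≥0) + 1) / (n + 1)) q.2 :=
      measurable_from_prod_countable_right fun k => hY (((k : ℝ≥0) + 1) / (n + 1))
    have h2 : Measurable fun q : ℝ≥0 × Ω => (⌊(n + 1 : ℝ≥0) * q.1⌋₊, q.2) := by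
      refine Measurable.prodMk (Nat.measurable_floor.comp ?_) measurable_snd
      exact measurable_fst.const_mul _
    have h3 := h1.comp h2
    simp only [Function.comp_def] at h3
    simpa only [τ] using h3
  refine measurable_of_tendsto_metrizable hτm (tendsto_pi_nhds.2 fun q => ?_)
  obtain ⟨t, ω⟩ := q
  have hge : ∀ n, t ≤ τ n t := by
    intro n
    rw [le_div_iff₀ (by positivity), mul_comm]
    exact (Nat.lt_floor_add_one _).le
  have hle : ∀ n : ℕ, τ n t ≤ t + 1 / ((n : ℝ≥0) + 1) := by
    intro n
    have hn : ((n : ℝ≥0) + 1) ≠ 0 := by positivity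
    rw [div_le_iff₀ (by positivity), add_mul _ _ ((n : ℝ≥0) + 1), one_div, inv_mul_cancel₀ hn,
      mul_comm t]
    exact add_le_add_left (Nat.floor_le (by positivity)) 1
  have hτ : Tendsto (fun n => τ n t) atTop (𝓝[≥] t) := by
    refine tendsto_nhdsWithin_iff.2 ⟨?_, Eventually.of_forall hge⟩
    refine tendsto_of_tendsto_of_tendsto_of_le_of_le tendsto_const_nhds ?_ hge hle
    have := (tendsto_one_div_add_atTop_nhds_zero_nat (𝕜 := ℝ≥0)).const_add t
    rwa [add_zero] at this
  exact (hc ω t).tendsto.comp hτ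

/-- `∫_0^t V(X_s) ds`. -/
def pathIntegral (V : S → ℝ) (X : ℝ≥0 → Ω → S) (t : ℝ) (ω : Ω) : ℝ :=
  ∫ s in (0 : ℝ)..t, V (X s.toNNReal ω)

variable {V : S → ℝ} {C : ℝ} {X : ℝ≥0 → Ω → S}

theorem measurable_comp_uncurry [MeasurableSpace Ω] (hX : ∀ t, Measurable (X t))
    (hc : ∀ ω t, ContinuousWithinAt (fun s => X s ω) (Set.Ici t) t) (hV : Measurable V) :
    Measurable fun q : ℝ × Ω => V (X q.1.toNNReal q.2) :=
  hV.comp ((measurable_uncurry_of_rightContinuous hX hc).comp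
    (measurable_fst.real_toNNReal.prodMk measurable_snd))

theorem measurable_pathIntegral [MeasurableSpace Ω] (hX : ∀ t, Measurable (X t))
    (hc : ∀ ω t, ContinuousWithinAt (fun s => X s ω) (Set.Ici t) t) (hV : Measurable V)
    (t : ℝ) : Measurable (pathIntegral V X t) := by
  unfold pathIntegral
  simp only [intervalIntegral]
  have h := (measurable_comp_uncurry hX hc hV).stronglyMeasurable
  exact h.integral_prod_left'.measurable.sub h.integral_prod_left'.measurable

/-- Up to time `t` the integral sees only the process stopped at `t`, all of whose coordinates are
`𝓕 t`-measurable and whose paths are still right-continuous. The previous lemma then applies with `𝓕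
t` as the σ-algebra. -/
theorem measurable_pathIntegral_filtration {mΩ : MeasurableSpace Ω} {𝓕 : Filtration ℝ≥0 mΩ}
    (hX : ∀ t, Measurable[𝓕 t] (X t))
    (hc : ∀ ω t, ContinuousWithinAt (fun s => X s ω) (Set.Ici t) t) (hV : Measurable V)
    {t : ℝ} (ht : 0 ≤ t) : Measurable[𝓕 t.toNNReal] (pathIntegral V X t) := by
  have h1 : pathIntegral V X t = pathIntegral V (fun s => X (min s t.toNNReal)) t := by
    funext ω
    refine intervalIntegral.integral_congr fun s hs => ?_
    rw [Set.uIcc_of_le ht] at hs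
    simp only
    rw [min_eq_left (Real.toNNReal_le_toNNReal hs.2)]
  rw [h1]
  refine @measurable_pathIntegral S Ω _ _ _ _ V _ (𝓕 t.toNNReal)
    (fun s => (hX _).mono (𝓕.mono (min_le_right _ _)) le_rfl) (fun ω s => ?_) hV t
  have h2 : Tendsto (fun r => min r t.toNNReal) (𝓝[≥] s) (𝓝[≥] (min s t.toNNReal)) := by
    refine tendsto_nhdsWithin_iff.2 ⟨?_, ?_⟩
    · exact ((continuous_id.min continuous_const).tendsto s).mono_left nhdsWithin_le_nhds
    · filter_upwards [self_mem_nhdsWithin] with r hr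
      exact min_le_min_right _ (Set.mem_Ici.1 hr)
  exact (hc ω _).tendsto.comp h2

theorem intervalIntegrable_comp [MeasurableSpace Ω] (hX : ∀ t, Measurable (X t))
    (hc : ∀ ω t, ContinuousWithinAt (fun s => X s ω) (Set.Ici t) t) (hV : Measurable V)
    (hb : ∀ x, |V x| ≤ C) (ω : Ω) (a b : ℝ) :
    IntervalIntegrable (fun s : ℝ => V (X s.toNNReal ω)) volume a b := by
  have hm : Measurable fun s : ℝ => V (X s.toNNReal ω) :=
    (measurable_comp_uncurry hX hc hV).comp (measurable_id.prodMk measurable_const)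
  exact (intervalIntegrable_const (c := C)).mono_fun hm.aestronglyMeasurable
    (ae_of_all _ fun s => (hb _).trans (le_abs_self C))

omit [PolishSpace S] [BorelSpace S] [TopologicalSpace S] [MeasurableSpace S] in
theorem abs_pathIntegral_le (hb : ∀ x, |V x| ≤ C) (ω : Ω) (t : ℝ) :
    |pathIntegral V X t ω| ≤ C * |t| := by
  have h := intervalIntegral.norm_integral_le_of_norm_le_const (a := 0) (b := t)
    (f := fun s : ℝ => V (X s.toNNReal ω)) (C := C) fun s _ => hb _
  rwa [sub_zero] at h

theorem pathIntegral_sub [MeasurableSpace Ω] (hX : ∀ t, Measurable (X t))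
    (hc : ∀ ω t, ContinuousWithinAt (fun s => X s ω) (Set.Ici t) t) (hV : Measurable V)
    (hb : ∀ x, |V x| ≤ C) (ω : Ω) (a b : ℝ) :
    pathIntegral V X b ω - pathIntegral V X a ω = ∫ s in a..b, V (X s.toNNReal ω) :=
  intervalIntegral.integral_interval_sub_left (intervalIntegrable_comp hX hc hV hb ω _ _)
    (intervalIntegrable_comp hX hc hV hb ω _ _)

theorem abs_pathIntegral_sub_le [MeasurableSpace Ω] (hX : ∀ t, Measurable (X t))
    (hc : ∀ ω t, ContinuousWithinAt (fun s => X s ω) (Set.Ici t) t) (hV : Measurable V)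
    (hb : ∀ x, |V x| ≤ C) (ω : Ω) (a b : ℝ) :
    |pathIntegral V X b ω - pathIntegral V X a ω| ≤ C * |b - a| := by
  rw [pathIntegral_sub hX hc hV hb, ← Real.norm_eq_abs]
  exact intervalIntegral.norm_integral_le_of_norm_le_const fun s _ => hb _

end Path

/-! ### Multiplication operators -/

section Mul

variable {S : Type*} [MeasurableSpace S] {μ : Measure S} {V : S → ℝ} {C : ℝ}

theorem memLp_mul (hV : Measurable V) (hb : ∀ x, |V x| ≤ C) (g : Lp ℝ 2 μ) :
    MemLp (fun x => V x * g x) 2 μ :=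
  (Lp.memLp g).of_le_mul (c := C)
    (hV.aestronglyMeasurable.mul (Lp.memLp g).1)
    (ae_of_all _ fun x => by rw [norm_mul]; gcongr; exact hb x)

/-- Multiplication by a bounded measurable function. -/
def mulOp (μ : Measure S) (hV : Measurable V) (hb : ∀ x, |V x| ≤ C) : Lp ℝ 2 μ →L[ℝ] Lp ℝ 2 μ :=
  LinearMap.mkContinuous
    { toFun := fun g => (memLp_mul hV hb g).toLp (fun x => V x * g x)
      map_add' := fun g g' => by
        rw [← MemLp.toLp_add, MemLp.toLp_eq_toLp_iff]
        filter_upwards [Lp.coeFn_add g g'] with x hx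
        rw [hx, Pi.add_apply, Pi.add_apply, mul_add]
      map_smul' := fun c g => by
        rw [RingHom.id_apply, ← MemLp.toLp_const_smul, MemLp.toLp_eq_toLp_iff]
        filter_upwards [Lp.coeFn_smul c g] with x hx
        rw [hx, Pi.smul_apply, Pi.smul_apply, smul_eq_mul, smul_eq_mul]
        ring }
    C (fun g => by
      refine Lp.norm_le_mul_norm_of_ae_le_mul ?_
      filter_upwards [MemLp.coeFn_toLp (memLp_mul hV hb g)] with x hx
      simp only [LinearMap.coe_mk, AddHom.coe_mk]
      rw [hx, norm_mul]
      gcongr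
      exact hb x)

theorem coeFn_mulOp (hV : Measurable V) (hb : ∀ x, |V x| ≤ C) (g : Lp ℝ 2 μ) :
    mulOp μ hV hb g =ᵐ[μ] fun x => V x * g x :=
  MemLp.coeFn_toLp (memLp_mul hV hb g)

theorem inner_mulOp_comm (hV : Measurable V) (hb : ∀ x, |V x| ≤ C) (g g' : Lp ℝ 2 μ) :
    ⟪mulOp μ hV hb g, g'⟫ = ⟪g, mulOp μ hV hb g'⟫ := by
  rw [L2.inner_def, L2.inner_def]
  refine integral_congr_ae ?_
  filter_upwards [coeFn_mulOp hV hb g, coeFn_mulOp hV hb g'] with x h1 h2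
  rw [h1, h2]
  simp only [RCLike.inner_apply, conj_trivial]
  ring

theorem inner_mulOp_self (hV : Measurable V) (hb : ∀ x, |V x| ≤ C) (g : Lp ℝ 2 μ) :
    ⟪mulOp μ hV hb g, g⟫ = ∫ x, V x * g x ^ 2 ∂μ := by
  rw [L2.inner_def]
  refine integral_congr_ae ?_
  filter_upwards [coeFn_mulOp hV hb g] with x h1
  rw [h1]
  simp only [RCLike.inner_apply, conj_trivial]
  ring

end Mul

/-! ### The Feynman-Kac bound -/

theorem abs_exp_sub_exp_le {a b M : ℝ} (ha : a ≤ M) (hb : b ≤ M) :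
    |Real.exp a - Real.exp b| ≤ Real.exp M * |a - b| := by
  have key : ∀ a b, a ≤ M → Real.exp a - Real.exp b ≤ Real.exp M * |a - b| := by
    intro a b ha
    have h1 := Real.add_one_le_exp (b - a)
    have h2 : Real.exp b = Real.exp a * Real.exp (b - a) := by rw [← Real.exp_add]; congr 1; ring
    calc Real.exp a - Real.exp b ≤ Real.exp a * (a - b) := by
          rw [h2]; nlinarith [Real.exp_pos a]
      _ ≤ Real.exp a * |a - b| := by gcongr; exact le_abs_self _
      _ ≤ Real.exp M * |a - b| := by gcongr
  rw [abs_le]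
  constructor
  · have := key b a hb
    rw [abs_sub_comm] at this
    linarith
  · exact key a b ha

theorem integral_abs_le_norm {Ω : Type*} [MeasurableSpace Ω] {ρ : Measure Ω}
    [IsProbabilityMeasure ρ] (F : Lp ℝ 2 ρ) : ∫ ω, |F ω| ∂ρ ≤ ‖F‖ := by
  have h1 : eLpNorm F 1 ρ ≤ eLpNorm F 2 ρ :=
    eLpNorm_le_eLpNorm_of_exponent_le (by norm_num) (Lp.memLp F).1
  have h2 := ENNReal.toReal_mono (Lp.memLp F).2.ne h1
  rw [eLpNorm_one_eq_lintegral_enorm, ← integral_norm_eq_lintegral_enorm (Lp.memLp F).1] at h2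
  exact h2

section Weight

variable {S Ω : Type*} [TopologicalSpace S] [PolishSpace S] [MeasurableSpace S] [BorelSpace S]
  [MeasurableSpace Ω] {V : S → ℝ} {C : ℝ} {X : ℝ≥0 → Ω → S}
  (hX : ∀ t, Measurable (X t))
  (hc : ∀ ω t, ContinuousWithinAt (fun s => X s ω) (Set.Ici t) t) (hV : Measurable V)
  (hb : ∀ x, |V x| ≤ C) (ρ : Measure Ω)

include hX hc hV hb in
theorem memLp_exp_pathIntegral [IsFiniteMeasure ρ] (t : ℝ) :
    MemLp (fun ω => Real.exp (pathIntegral V X t ω)) 2 ρ :=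
  MemLp.of_bound (measurable_pathIntegral hX hc hV t).exp.aestronglyMeasurable
    (Real.exp (C * |t|)) (ae_of_all _ fun ω => by
      rw [Real.norm_of_nonneg (Real.exp_pos _).le]
      exact Real.exp_le_exp.2 ((le_abs_self _).trans (abs_pathIntegral_le hb ω t)))

/-- `exp (∫_0^t V(X_s) ds)`, as an element of `L²`. -/
def expWeight [IsFiniteMeasure ρ] (t : ℝ) : Lp ℝ 2 ρ :=
  (memLp_exp_pathIntegral hX hc hV hb ρ t).toLp (fun ω => Real.exp (pathIntegral V X t ω))

theorem coeFn_expWeight [IsFiniteMeasure ρ] (t : ℝ) :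
    expWeight hX hc hV hb ρ t =ᵐ[ρ] fun ω => Real.exp (pathIntegral V X t ω) :=
  MemLp.coeFn_toLp _

variable [IsProbabilityMeasure ρ]

theorem norm_expWeight_add_sub_le (hC : 0 ≤ C) {t h T : ℝ} (ht : 0 ≤ t) (hh : 0 ≤ h)
    (hT : t + h ≤ T) :
    ‖expWeight hX hc hV hb ρ (t + h) - expWeight hX hc hV hb ρ t‖
      ≤ Real.exp (C * T) * C * h := by
  have h1 : 0 ≤ Real.exp (C * T) * C * h := by positivity
  refine (Lp.norm_le_of_ae_bound h1 ?_).trans_eq (by simp [measureUnivNNReal])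
  filter_upwards [Lp.coeFn_sub (expWeight hX hc hV hb ρ (t + h)) (expWeight hX hc hV hb ρ t),
    coeFn_expWeight hX hc hV hb ρ (t + h), coeFn_expWeight hX hc hV hb ρ t] with ω e1 e2 e3
  rw [e1, Pi.sub_apply, e2, e3, Real.norm_eq_abs]
  have hM : ∀ s, 0 ≤ s → s ≤ T → pathIntegral V X s ω ≤ C * T := by
    intro s hs hsT
    refine (le_abs_self _).trans ((abs_pathIntegral_le hb ω s).trans ?_)
    rw [abs_of_nonneg hs]
    gcongr
  refine (abs_exp_sub_exp_le (hM _ (by linarith) hT) (hM _ ht (by linarith))).trans ?_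
  have h2 := abs_pathIntegral_sub_le hX hc hV hb ω t (t + h)
  rw [add_sub_cancel_left, abs_of_nonneg hh] at h2
  rw [mul_assoc]
  gcongr

include hX hc hV hb in
/-- The right derivative of `t ↦ exp (∫_0^t V(X_s) ds)`, pointwise with an error term. -/
theorem abs_slope_exp_pathIntegral_le (hC : 0 ≤ C) {t h : ℝ} (ht : 0 ≤ t) (hh : 0 < h)
    (hh1 : C * h ≤ 1) (ω : Ω) :
    (h⁻¹ * (Real.exp (pathIntegral V X (t + h) ω) - Real.exp (pathIntegral V X t ω))
      - Real.exp (pathIntegral V X t ω) * V (X t.toNNReal ω)) ^ 2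
    ≤ 3 * C * Real.exp (C * t) ^ 2 *
      (C ^ 2 * h + h⁻¹ * ∫ s in t..(t + h), |V (X s.toNNReal ω) - V (X t.toNNReal ω)|) := by
  set I := pathIntegral V X t ω with hI
  set D := ∫ s in t..(t + h), V (X s.toNNReal ω) with hD
  set E := ∫ s in t..(t + h), |V (X s.toNNReal ω) - V (X t.toNNReal ω)| with hE
  have hle : t ≤ t + h := by linarith
  have hdiff : pathIntegral V X (t + h) ω = I + D := by
    rw [hD, ← pathIntegral_sub hX hc hV hb]; ring
  have hDabs : |D| ≤ C * h := by
    have h2 := abs_pathIntegral_sub_le hX hc hV hb ω t (t + h)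
    rwa [hdiff, add_sub_cancel_left, add_sub_cancel_left, abs_of_pos hh] at h2
  have hint := intervalIntegrable_comp hX hc hV hb ω t (t + h)
  have hDE : |D - h * V (X t.toNNReal ω)| ≤ E := by
    have h1 : D - h * V (X t.toNNReal ω)
        = ∫ s in t..(t + h), (V (X s.toNNReal ω) - V (X t.toNNReal ω)) := by
      rw [intervalIntegral.integral_sub hint intervalIntegrable_const,
        intervalIntegral.integral_const, add_sub_cancel_left, smul_eq_mul]
    rw [h1]
    exact intervalIntegral.abs_integral_le_integral_abs hle
  have hE2 : E ≤ 2 * C * h := by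
    have h1 := intervalIntegral.norm_integral_le_of_norm_le_const (a := t) (b := t + h)
      (f := fun s : ℝ => |V (X s.toNNReal ω) - V (X t.toNNReal ω)|) (C := 2 * C) fun s _ => by
        rw [Real.norm_eq_abs, abs_abs]
        exact (abs_sub _ _).trans (by linarith [hb (X s.toNNReal ω), hb (X t.toNNReal ω)])
    rw [add_sub_cancel_left, abs_of_pos hh] at h1
    exact (le_abs_self _).trans h1
  have hexp : |Real.exp D - 1 - D| ≤ C ^ 2 * h ^ 2 := by
    refine (Real.abs_exp_sub_one_sub_id_le (hDabs.trans hh1)).trans ?_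
    rw [← sq_abs, ← mul_pow]
    gcongr
  have hIle : Real.exp I ≤ Real.exp (C * t) := by
    refine Real.exp_le_exp.2 ((le_abs_self _).trans ((abs_pathIntegral_le hb ω t).trans_eq ?_))
    rw [abs_of_nonneg ht]
  have hq : h⁻¹ * (Real.exp (pathIntegral V X (t + h) ω) - Real.exp I)
      - Real.exp I * V (X t.toNNReal ω)
      = Real.exp I * (h⁻¹ * ((Real.exp D - 1 - D) + (D - h * V (X t.toNNReal ω)))) := by
    rw [hdiff, Real.exp_add]
    field_simp
    ring
  set r := h⁻¹ * ((Real.exp D - 1 - D) + (D - h * V (X t.toNNReal ω))) with hr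
  have hr1 : |r| ≤ C ^ 2 * h + h⁻¹ * E := by
    rw [hr, abs_mul, abs_of_pos (inv_pos.2 hh)]
    calc h⁻¹ * |(Real.exp D - 1 - D) + (D - h * V (X t.toNNReal ω))|
        ≤ h⁻¹ * (C ^ 2 * h ^ 2 + E) := by
          gcongr
          exact (abs_add_le _ _).trans (add_le_add hexp hDE)
      _ = C ^ 2 * h + h⁻¹ * E := by field_simp
  -- In `|r| * |r|` one factor gets this crude bound and the other the error bound `hr1`. The square
  -- is thus linear in the oscillation of `V(X_s)`, so an `L¹` estimate of that oscillation yields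
  -- `L²` convergence.
  have hr2 : |r| ≤ 3 * C := by
    refine hr1.trans ?_
    have h1 : h⁻¹ * E ≤ 2 * C := by
      rw [inv_mul_le_iff₀ hh]; linarith
    have h2 : C ^ 2 * h ≤ C := by
      calc C ^ 2 * h = C * (C * h) := by ring
        _ ≤ C * 1 := by gcongr
        _ = C := mul_one C
    linarith
  rw [hq, mul_pow, ← sq_abs r, sq |r|]
  calc Real.exp I ^ 2 * (|r| * |r|)
      ≤ Real.exp (C * t) ^ 2 * ((3 * C) * (C ^ 2 * h + h⁻¹ * E)) := by gcongr
    _ = _ := by ring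

end Weight

/-! ### Conditional expectation given the present state -/

namespace IsStationaryMarkov

variable {S Ω : Type*} [MeasurableSpace S] {mΩ : MeasurableSpace Ω} {𝓕 : Filtration ℝ≥0 mΩ}
  {X : ℝ≥0 → Ω → S} {p : ℝ≥0 → Kernel S S} {μ : Measure S} {ρ : Measure Ω}

theorem measurable' (h : IsStationaryMarkov 𝓕 X p μ ρ) (t : ℝ≥0) : Measurable (X t) :=
  (h.measurable t).mono (𝓕.le t) le_rfl

/-- The adjoint of `g ↦ g(X_t)`: the conditional expectation given `X_t`. -/
def push (h : IsStationaryMarkov 𝓕 X p μ ρ) (t : ℝ≥0) : Lp ℝ 2 ρ →L[ℝ] Lp ℝ 2 μ :=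
  ContinuousLinearMap.adjoint (h.pullback t).toContinuousLinearMap

theorem inner_push (h : IsStationaryMarkov 𝓕 X p μ ρ) (t : ℝ≥0) (F : Lp ℝ 2 ρ) (g : Lp ℝ 2 μ) :
    ⟪h.push t F, g⟫ = ⟪F, h.pullback t g⟫ :=
  ContinuousLinearMap.adjoint_inner_left _ _ _

theorem norm_push_apply_le (h : IsStationaryMarkov 𝓕 X p μ ρ) (t : ℝ≥0) (F : Lp ℝ 2 ρ) :
    ‖h.push t F‖ ≤ ‖F‖ := by
  refine ((h.push t).le_of_opNorm_le (c := 1) ?_ F).trans_eq (one_mul _)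
  rw [push, LinearIsometryEquiv.norm_map]
  exact (h.pullback t).norm_toContinuousLinearMap_le

variable [∀ t, IsMarkovKernel (p t)] [IsProbabilityMeasure μ] {hμ : ∀ t, (p t).Invariant μ}

/-- This is the dual of `inner_pullback_add`. Symmetry of the semigroup enters here: without it the
adjoint semigroup would appear on the right. -/
theorem push_add (h : IsStationaryMarkov 𝓕 X p μ ρ)
    (hQ : IsContractionSemigroup (semigroup p μ hμ))
    (hsa : IsSelfAdjoint (generator (semigroup p μ hμ))) (s t : ℝ≥0) {W : Ω → ℝ}
    (hW : StronglyMeasurable[𝓕 s] W) {C : ℝ} (hC : ∀ ω, |W ω| ≤ C) (hW2 : MemLp W 2 ρ) :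
    h.push (t + s) (hW2.toLp W) = semigroup p μ hμ t (h.push s (hW2.toLp W)) := by
  refine ext_inner_right ℝ fun g => ?_
  rw [hQ.inner_apply_comm hsa, inner_push, inner_push, h.inner_pullback_add hμ s t hW hC]

/-- By stationarity both terms have norm `‖v‖`, and by the Markov property their inner product is
`⟪v, Q_t v⟫`. The square is therefore `2 (‖v‖² - ⟪v, Q_t v⟫)`: strong continuity of the semigroup
replaces continuity of `V`. -/
theorem norm_pullback_sub_sq_le (h : IsStationaryMarkov 𝓕 X p μ ρ) {V : S → ℝ} {C : ℝ}
    (hV : Measurable V) (hb : ∀ x, |V x| ≤ C) (hV2 : MemLp V 2 μ) (s t : ℝ≥0) :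
    ‖h.pullback (t + s) (hV2.toLp V) - h.pullback s (hV2.toLp V)‖ ^ 2
      ≤ 2 * ‖hV2.toLp V‖ * ‖semigroup p μ hμ t (hV2.toLp V) - hV2.toLp V‖ := by
  set v := hV2.toLp V with hv
  have hW2 : MemLp (fun ω => V (X s ω)) 2 ρ := hV2.comp_measurePreserving (h.measurePreserving s)
  have e1 : h.pullback s v = hW2.toLp _ := by
    refine Lp.ext ?_
    filter_upwards [h.coeFn_pullback s v, hW2.coeFn_toLp,
      (h.measurePreserving s).quasiMeasurePreserving.ae hV2.coeFn_toLp] with ω h1 h2 h3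
    rw [h1, h2, h3]
  have e2 := h.inner_pullback_add hμ s t (hV.comp (h.measurable s)).stronglyMeasurable
    (fun ω => hb (X s ω)) hW2 v
  simp only [Function.comp_def] at e2
  rw [← e1, LinearIsometry.inner_map_map] at e2
  rw [norm_sub_sq_real, LinearIsometry.norm_map, LinearIsometry.norm_map, real_inner_comm, e2]
  have e3 : ⟪v, semigroup p μ hμ t v - v⟫ = ⟪v, semigroup p μ hμ t v⟫ - ‖v‖ ^ 2 := by
    rw [inner_sub_right, real_inner_self_eq_norm_sq]
  have e4 := (abs_le.1 (abs_real_inner_le_norm v (semigroup p μ hμ t v - v))).1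
  linarith

end IsStationaryMarkov

namespace IsStationaryMarkov

variable {S Ω : Type*} [MeasurableSpace S]
  {mΩ : MeasurableSpace Ω} {𝓕 : Filtration ℝ≥0 mΩ}
  {X : ℝ≥0 → Ω → S} {p : ℝ≥0 → Kernel S S} {μ : Measure S} {ρ : Measure Ω}
  [IsProbabilityMeasure ρ] {V : S → ℝ} {C : ℝ}

theorem integral_abs_comp_sub_le (h : IsStationaryMarkov 𝓕 X p μ ρ)
    (hV2 : MemLp V 2 μ) (s t : ℝ≥0) :
    ∫ ω, |V (X s ω) - V (X t ω)| ∂ρ ≤ ‖h.pullback s (hV2.toLp V) - h.pullback t (hV2.toLp V)‖ := by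
  refine (integral_congr_ae ?_).trans_le (integral_abs_le_norm _)
  filter_upwards [Lp.coeFn_sub (h.pullback s (hV2.toLp V)) (h.pullback t (hV2.toLp V)),
    h.coeFn_pullback s (hV2.toLp V), h.coeFn_pullback t (hV2.toLp V),
    (h.measurePreserving s).quasiMeasurePreserving.ae hV2.coeFn_toLp,
    (h.measurePreserving t).quasiMeasurePreserving.ae hV2.coeFn_toLp] with ω h1 h2 h3 h4 h5
  rw [h1, Pi.sub_apply, h2, h3, h4, h5]

variable [TopologicalSpace S] [PolishSpace S] [BorelSpace S]

theorem memLp_weight (h : IsStationaryMarkov 𝓕 X p μ ρ)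
    (hc : ∀ ω t, ContinuousWithinAt (fun s => X s ω) (Set.Ici t) t) (hV : Measurable V)
    (hb : ∀ x, |V x| ≤ C) (t : ℝ) :
    MemLp (fun ω => Real.exp (pathIntegral V X t ω) * V (X t.toNNReal ω)) 2 ρ :=
  (memLp_exp_pathIntegral h.measurable' hc hV hb ρ t).of_le_mul (c := C)
    ((measurable_pathIntegral h.measurable' hc hV t).exp.mul
      (hV.comp (h.measurable' _))).aestronglyMeasurable
    (ae_of_all _ fun ω => by rw [norm_mul, mul_comm]; gcongr; exact hb _)

/-- The pointwise bound is integrated over `Ω`. Fubini turns the oscillation term into a time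
average of `L¹` distances, each at most `η`. -/
theorem norm_slope_expWeight_sq_le (h : IsStationaryMarkov 𝓕 X p μ ρ)
    (hc : ∀ ω t, ContinuousWithinAt (fun s => X s ω) (Set.Ici t) t) (hV : Measurable V)
    (hb : ∀ x, |V x| ≤ C) (hC : 0 ≤ C) (hV2 : MemLp V 2 μ) {t r : ℝ} (ht : 0 ≤ t) (hr : 0 < r)
    (hr1 : C * r ≤ 1) {η : ℝ} (hη : ∀ s ∈ Set.Icc t (t + r),
      ‖h.pullback s.toNNReal (hV2.toLp V) - h.pullback t.toNNReal (hV2.toLp V)‖ ≤ η) :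
    ‖r⁻¹ • (expWeight h.measurable' hc hV hb ρ (t + r) - expWeight h.measurable' hc hV hb ρ t)
      - (h.memLp_weight hc hV hb t).toLp _‖ ^ 2
    ≤ 3 * C * Real.exp (C * t) ^ 2 * (C ^ 2 * r + η) := by
  set W := expWeight h.measurable' hc hV hb ρ with hW
  set Z := (h.memLp_weight hc hV hb t).toLp _ with hZ
  have hle : t ≤ t + r := by linarith
  let F : ℝ × Ω → ℝ := fun q => |V (X q.1.toNNReal q.2) - V (X t.toNNReal q.2)|
  have hFm : Measurable F :=
    ((measurable_comp_uncurry h.measurable' hc hV).sub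
      ((hV.comp (h.measurable' t.toNNReal)).comp measurable_snd)).abs
  have hFb : ∀ q, |F q| ≤ 2 * C := fun q => by
    simp only [F, abs_abs]
    exact (abs_sub _ _).trans (by linarith [hb (X q.1.toNNReal q.2), hb (X t.toNNReal q.2)])
  have hFi : Integrable F ((volume.restrict (Set.Ioc t (t + r))).prod ρ) :=
    Integrable.of_bound hFm.aestronglyMeasurable (2 * C) (ae_of_all _ hFb)
  have hEi : Integrable (fun ω => ∫ s in t..(t + r), F (s, ω)) ρ := by
    simp only [intervalIntegral.integral_of_le hle]
    exact hFi.integral_prod_right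
  have hswap : ∫ ω, (∫ s in t..(t + r), F (s, ω)) ∂ρ = ∫ s in t..(t + r), ∫ ω, F (s, ω) ∂ρ := by
    simp only [intervalIntegral.integral_of_le hle]
    exact (integral_integral_swap (f := fun s ω => F (s, ω)) hFi).symm
  have hE : ∫ ω, (∫ s in t..(t + r), F (s, ω)) ∂ρ ≤ r * η := by
    rw [hswap]
    refine (le_abs_self _).trans ?_
    have h1 := intervalIntegral.norm_integral_le_of_norm_le_const (a := t) (b := t + r)
      (f := fun s => ∫ ω, F (s, ω) ∂ρ) (C := η) fun s hs => by
        rw [Set.uIoc_of_le hle] at hs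
        rw [Real.norm_of_nonneg (integral_nonneg fun ω => abs_nonneg _)]
        exact (h.integral_abs_comp_sub_le hV2 _ _).trans (hη s ⟨hs.1.le, hs.2⟩)
    rw [add_sub_cancel_left, abs_of_pos hr, mul_comm] at h1
    exact h1
  rw [← real_inner_self_eq_norm_sq, L2.inner_def]
  set K := 3 * C * Real.exp (C * t) ^ 2 with hK
  have hK0 : 0 ≤ K := by positivity
  calc ∫ ω, ⟪(r⁻¹ • (W (t + r) - W t) - Z : Lp ℝ 2 ρ) ω, (r⁻¹ • (W (t + r) - W t) - Z : Lp ℝ 2 ρ) ω⟫ ∂ρ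
      ≤ ∫ ω, K * (C ^ 2 * r + r⁻¹ * ∫ s in t..(t + r), F (s, ω)) ∂ρ := by
        refine integral_mono_ae (L2.integrable_inner _ _)
          (((integrable_const _).add (hEi.const_mul _)).const_mul _) ?_
        filter_upwards [Lp.coeFn_sub (r⁻¹ • (W (t + r) - W t)) Z,
          Lp.coeFn_smul r⁻¹ (W (t + r) - W t), Lp.coeFn_sub (W (t + r)) (W t),
          coeFn_expWeight h.measurable' hc hV hb ρ (t + r),
          coeFn_expWeight h.measurable' hc hV hb ρ t,
          (h.memLp_weight hc hV hb t).coeFn_toLp] with ω e1 e2 e3 e4 e5 e6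
        rw [e1, Pi.sub_apply, e2, Pi.smul_apply, e3, Pi.sub_apply, e4, e5, e6, smul_eq_mul,
          RCLike.inner_apply, conj_trivial, ← sq]
        exact abs_slope_exp_pathIntegral_le h.measurable' hc hV hb hC ht hr hr1 ω
    _ = K * (C ^ 2 * r + r⁻¹ * ∫ ω, (∫ s in t..(t + r), F (s, ω)) ∂ρ) := by
        rw [integral_const_mul, integral_add (integrable_const _) (hEi.const_mul _),
          integral_const_mul r⁻¹, integral_const, probReal_univ, one_smul]
    _ ≤ K * (C ^ 2 * r + η) := by
        gcongr
        rw [inv_mul_le_iff₀ hr]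
        exact hE

/-- The factor `V(X_t)` is a function of `X_t`, so it comes out of the conditional expectation given
`X_t` as a multiplication operator. -/
theorem push_weight (h : IsStationaryMarkov 𝓕 X p μ ρ)
    (hc : ∀ ω t, ContinuousWithinAt (fun s => X s ω) (Set.Ici t) t) (hV : Measurable V)
    (hb : ∀ x, |V x| ≤ C) (t : ℝ) :
    h.push t.toNNReal ((h.memLp_weight hc hV hb t).toLp _)
      = mulOp μ hV hb (h.push t.toNNReal (expWeight h.measurable' hc hV hb ρ t)) := by
  refine ext_inner_right ℝ fun g => ?_
  rw [inner_mulOp_comm, inner_push, inner_push, L2.inner_def, L2.inner_def]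
  refine integral_congr_ae ?_
  filter_upwards [(h.memLp_weight hc hV hb t).coeFn_toLp,
    coeFn_expWeight h.measurable' hc hV hb ρ t, h.coeFn_pullback t.toNNReal g,
    h.coeFn_pullback t.toNNReal (mulOp μ hV hb g),
    (h.measurePreserving t.toNNReal).quasiMeasurePreserving.ae (coeFn_mulOp hV hb g)]
    with ω e1 e2 e3 e4 e5
  rw [e1, e2, e3, e4, e5]
  simp only [RCLike.inner_apply, conj_trivial]
  ring

variable [∀ t, IsMarkovKernel (p t)] [IsProbabilityMeasure μ] {hμ : ∀ t, (p t).Invariant μ}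

/-- Paths of `V(X_s)` may be discontinuous, so a pointwise derivative at `t` is not available. The
derivative is taken in `L²`, where `norm_pullback_sub_sq_le` makes the oscillation small. -/
theorem tendsto_slope_expWeight (h : IsStationaryMarkov 𝓕 X p μ ρ)
    (hQ : IsContractionSemigroup (semigroup p μ hμ))
    (hc : ∀ ω t, ContinuousWithinAt (fun s => X s ω) (Set.Ici t) t) (hV : Measurable V)
    (hb : ∀ x, |V x| ≤ C) (hC : 0 ≤ C) {t : ℝ} (ht : 0 ≤ t) :
    Tendsto (fun r : ℝ => r⁻¹ • (expWeight h.measurable' hc hV hb ρ (t + r)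
      - expWeight h.measurable' hc hV hb ρ t)) (𝓝[>] 0)
      (𝓝 ((h.memLp_weight hc hV hb t).toLp _)) := by
  have hV2 : MemLp V 2 μ := memLp_of_bdd hV ⟨C, hb⟩
  set v := hV2.toLp V with hv
  set K := 3 * C * Real.exp (C * t) ^ 2 with hK
  have hK0 : 0 ≤ K := by positivity
  have hJ : Tendsto (fun s : ℝ => √(2 * ‖v‖ * ‖semigroup p μ hμ s.toNNReal v - v‖)) (𝓝 0) (𝓝 0) := by
    have h1 := ((hQ.continuous_real v).tendsto 0)
    rw [Real.toNNReal_zero, hQ.zero_apply] at h1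
    have h2 := ((h1.sub_const v).norm.const_mul (2 * ‖v‖)).sqrt
    simpa using h2
  rw [tendsto_iff_norm_sub_tendsto_zero, Metric.tendsto_nhds]
  intro ε hε
  set η := ε ^ 2 / (4 * (K + 1)) with hη
  have hη0 : 0 < η := by positivity
  have hKη : K * (2 * η) < ε ^ 2 := by
    have h1 : (K + 1) * η = ε ^ 2 / 4 := by rw [hη]; field_simp
    nlinarith [sq_nonneg ε]
  obtain ⟨δ, hδ, hJδ⟩ := Metric.tendsto_nhds_nhds.1 hJ η hη0
  have hs1 : Tendsto (fun r : ℝ => C * r) (𝓝 0) (𝓝 (C * 0)) :=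
    (continuous_const.mul continuous_id).tendsto 0
  have hs2 : Tendsto (fun r : ℝ => C ^ 2 * r) (𝓝 0) (𝓝 (C ^ 2 * 0)) :=
    (continuous_const.mul continuous_id).tendsto 0
  rw [mul_zero] at hs1 hs2
  filter_upwards [self_mem_nhdsWithin,
    nhdsWithin_le_nhds (hs1.eventually_lt_const one_pos),
    nhdsWithin_le_nhds (hs2.eventually_lt_const hη0),
    nhdsWithin_le_nhds (Iio_mem_nhds hδ)] with r hr hr1 hr2 hr3
  have hr0 : 0 < r := hr
  have key := h.norm_slope_expWeight_sq_le hc hV hb hC hV2 ht hr0 hr1.le (η := η) fun s hs => by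
    have hst : s.toNNReal = (s - t).toNNReal + t.toNNReal := by
      rw [← Real.toNNReal_add (by linarith [hs.1]) ht, sub_add_cancel]
    have h1 := h.norm_pullback_sub_sq_le (hμ := hμ) hV hb hV2 t.toNNReal (s - t).toNNReal
    rw [← hst] at h1
    have h2 := hJδ (x := s - t) (by
      rw [Real.dist_eq, sub_zero, abs_of_nonneg (by linarith [hs.1])]
      have : r < δ := hr3
      linarith [hs.2])
    rw [Real.dist_eq, sub_zero, abs_of_nonneg (Real.sqrt_nonneg _)] at h2
    exact (Real.le_sqrt (norm_nonneg _)  (by positivity)).2 h1 |>.trans h2.le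
  rw [dist_zero_right, norm_norm]
  refine lt_of_pow_lt_pow_left₀ 2 hε.le (key.trans_lt ?_)
  calc K * (C ^ 2 * r + η) ≤ K * (2 * η) := by gcongr; linarith
    _ < ε ^ 2 := hKη

/-- The Feynman-Kac bound. -/
theorem integral_exp_pathIntegral_le (h : IsStationaryMarkov 𝓕 X p μ ρ)
    (hQ : IsContractionSemigroup (semigroup p μ hμ))
    (hsa : IsSelfAdjoint (generator (semigroup p μ hμ)))
    (hc : ∀ ω t, ContinuousWithinAt (fun s => X s ω) (Set.Ici t) t) (hV : Measurable V)
    (hb : ∀ x, |V x| ≤ C) {κ : ℝ}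
    (hκ : ∀ g : (generator (semigroup p μ hμ)).domain, ‖(g : Lp ℝ 2 μ)‖ = 1 →
      ⟪generator (semigroup p μ hμ) g, (g : Lp ℝ 2 μ)⟫ + ∫ x, V x * (g : Lp ℝ 2 μ) x ^ 2 ∂μ ≤ κ)
    {T : ℝ} (hT : 0 ≤ T) :
    ∫ ω, Real.exp (pathIntegral V X T ω) ∂ρ ≤ Real.exp (κ * T) := by
  have hS : Nonempty S := μ.nonempty_of_neZero
  have hC : 0 ≤ C := (abs_nonneg _).trans (hb hS.some)
  set W := expWeight h.measurable' hc hV hb ρ with hW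
  -- Conditioning the weight of the past on the present state gives a curve driven by the adjoint of
  -- the generator plus `V`, and the generator is its own adjoint.
  set u : ℝ → Lp ℝ 2 μ := fun t => h.push t.toNNReal (W t) with hu
  have hadapt : ∀ t, 0 ≤ t → StronglyMeasurable[𝓕 t.toNNReal]
      fun ω => Real.exp (pathIntegral V X t ω) := fun t ht =>
    (Real.measurable_exp.comp
      (measurable_pathIntegral_filtration h.measurable hc hV ht)).stronglyMeasurable
  have habs : ∀ t ω, |Real.exp (pathIntegral V X t ω)| ≤ Real.exp (C * |t|) := fun t ω => by
    rw [abs_of_pos (Real.exp_pos _)]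
    exact Real.exp_le_exp.2 ((le_abs_self _).trans (abs_pathIntegral_le hb ω t))
  have hpush : ∀ t r, 0 ≤ t → 0 ≤ r →
      h.push (t + r).toNNReal (W t) = semigroup p μ hμ r.toNNReal (u t) := by
    intro t r ht hr
    rw [add_comm t, Real.toNNReal_add hr ht]
    exact h.push_add hQ hsa t.toNNReal r.toNNReal (hadapt t ht) (habs t)
      (memLp_exp_pathIntegral h.measurable' hc hV hb ρ t)
  have hpush' : ∀ t r, 0 ≤ t → 0 ≤ r →
      h.push (t + r).toNNReal ((h.memLp_weight hc hV hb t).toLp _)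
        = semigroup p μ hμ r.toNNReal (mulOp μ hV hb (u t)) := by
    intro t r ht hr
    rw [add_comm t, Real.toNNReal_add hr ht, hu, ← h.push_weight hc hV hb]
    refine h.push_add hQ hsa t.toNNReal r.toNNReal (C := Real.exp (C * |t|) * C)
      ((hadapt t ht).mul (hV.comp (h.measurable t.toNNReal)).stronglyMeasurable) (fun ω => ?_) _
    rw [Pi.mul_apply, abs_mul]
    gcongr
    · exact habs t ω
    · exact hb _
  -- The defect of `u` from the free flow is the push of an increment of the weight. A Lipschitz
  -- bound on the weight then gives continuity of `u`, and its `L²` derivative gives the evolution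
  -- equation.
  have hdiff : ∀ t r, 0 ≤ t → 0 ≤ r → u (t + r) - semigroup p μ hμ r.toNNReal (u t)
      = h.push (t + r).toNNReal (W (t + r) - W t) := by
    intro t r ht hr
    rw [map_sub, hpush t r ht hr]
  have hcont : ContinuousOn u (Set.Icc 0 T) := by
    refine hQ.continuousOn_of_norm_sub_le (K := Real.exp (C * T) * C) (by positivity)
      fun t r ht hr htr => ?_
    rw [hdiff t r ht hr]
    exact (h.norm_push_apply_le _ _).trans
      (norm_expWeight_add_sub_le h.measurable' hc hV hb ρ hC ht hr htr)
  have hder : ∀ t ∈ Set.Ico 0 T, Tendsto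
      (fun r : ℝ => r⁻¹ • (u (t + r) - semigroup p μ hμ r.toNNReal (u t))) (𝓝[>] 0)
      (𝓝 (mulOp μ hV hb (u t))) := by
    intro t ht
    set Z := (h.memLp_weight hc hV hb t).toLp _ with hZ
    have h1 := h.tendsto_slope_expWeight hQ hc hV hb hC ht.1
    rw [tendsto_iff_norm_sub_tendsto_zero] at h1
    have h2 : Tendsto (fun r : ℝ => h.push (t + r).toNNReal (r⁻¹ • (W (t + r) - W t) - Z))
        (𝓝[>] 0) (𝓝 0) := squeeze_zero_norm (fun r => h.norm_push_apply_le _ _) h1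
    have h3 := ((hQ.continuous_real (mulOp μ hV hb (u t))).tendsto 0).mono_left
      (nhdsWithin_le_nhds (s := Set.Ioi 0))
    rw [Real.toNNReal_zero, hQ.zero_apply] at h3
    have h4 := h2.add h3
    rw [zero_add] at h4
    refine h4.congr' ?_
    filter_upwards [self_mem_nhdsWithin] with r hr
    have hr0 : 0 ≤ r := le_of_lt hr
    rw [map_sub, map_smul, hpush' t r ht.1 hr0, hdiff t r ht.1 hr0, sub_add_cancel]
  have hκ' : ∀ g : (generator (semigroup p μ hμ)).domain,
      ⟪generator (semigroup p μ hμ) g, (g : Lp ℝ 2 μ)⟫ + ⟪mulOp μ hV hb g, (g : Lp ℝ 2 μ)⟫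
        ≤ κ * ‖(g : Lp ℝ 2 μ)‖ ^ 2 := by
    intro g
    rcases eq_or_ne (g : Lp ℝ 2 μ) 0 with hg | hg
    · rw [hg]; simp
    · have hn : ‖(g : Lp ℝ 2 μ)‖ ≠ 0 := norm_ne_zero_iff.2 hg
      have h1 := hκ (‖(g : Lp ℝ 2 μ)‖⁻¹ • g) (by
        rw [Submodule.coe_smul, norm_smul, norm_inv, norm_norm, inv_mul_cancel₀ hn])
      rw [← inner_mulOp_self hV hb, LinearPMap.map_smul, Submodule.coe_smul, map_smul] at h1
      simp only [real_inner_smul_left, real_inner_smul_right] at h1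
      have h2 : 0 < ‖(g : Lp ℝ 2 μ)‖ ^ 2 := by positivity
      rw [← div_le_iff₀ h2]
      refine le_trans (le_of_eq ?_) h1
      field_simp
  have hmain := hQ.norm_le_of_tendsto hκ' hT hcont hder
  have hu0 : ‖u 0‖ ≤ 1 := by
    refine (h.norm_push_apply_le _ _).trans ?_
    refine (Lp.norm_le_of_ae_bound zero_le_one ?_).trans_eq (by simp [measureUnivNNReal])
    filter_upwards [coeFn_expWeight h.measurable' hc hV hb ρ 0] with ω hω
    rw [hω]
    simp [pathIntegral]
  have hone : ∫ ω, Real.exp (pathIntegral V X T ω) ∂ρ = ⟪u T, Lp.const 2 μ (1 : ℝ)⟫ := by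
    rw [hu, inner_push, L2.inner_def]
    refine integral_congr_ae ?_
    filter_upwards [coeFn_expWeight h.measurable' hc hV hb ρ T,
      h.coeFn_pullback T.toNNReal (Lp.const 2 μ (1 : ℝ)),
      (h.measurePreserving T.toNNReal).quasiMeasurePreserving.ae (Lp.coeFn_const 2 μ (1 : ℝ))]
      with ω e1 e2 e3
    rw [e1, e2, e3]
    simp
  have hn1 : ‖Lp.const 2 μ (1 : ℝ)‖ ≤ 1 := by
    refine (Lp.norm_const_le 2 μ (1 : ℝ)).trans_eq ?_
    simp
  rw [hone]
  calc ⟪u T, Lp.const 2 μ (1 : ℝ)⟫ ≤ ‖u T‖ * ‖Lp.const 2 μ (1 : ℝ)‖ := real_inner_le_norm _ _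
    _ ≤ ‖u T‖ * 1 := by gcongr
    _ ≤ 1 * Real.exp (κ * T) := by
        rw [mul_one]
        exact hmain.trans (by gcongr)
    _ = _ := one_mul _

end IsStationaryMarkov

/-! ### The Gibbs variational principle -/

/-- The relative entropy of `Q` with respect to `P` tilted by `Y` is nonnegative; expanding the
log-likelihood ratio of the tilted measure gives the inequality. -/
theorem integral_le_klDiv_add_log {Ω : Type*} [MeasurableSpace Ω] {Q P : Measure Ω}
    [IsProbabilityMeasure Q] [IsProbabilityMeasure P] {Y : Ω → ℝ} (hY : Measurable Y) {C : ℝ}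
    (hC : ∀ ω, |Y ω| ≤ C) (h : InformationTheory.klDiv Q P ≠ ∞) :
    ∫ ω, Y ω ∂Q ≤ (InformationTheory.klDiv Q P).toReal + Real.log (∫ ω, Real.exp (Y ω) ∂P) := by
  obtain ⟨hac, hint⟩ := InformationTheory.klDiv_ne_top_iff.1 h
  have hYQ : Integrable Y Q := Integrable.of_bound hY.aestronglyMeasurable C (ae_of_all _ hC)
  have hexp : Integrable (fun ω => Real.exp (Y ω)) P :=
    Integrable.of_bound hY.exp.aestronglyMeasurable (Real.exp C) (ae_of_all _ fun ω => by
      rw [Real.norm_of_nonneg (Real.exp_pos _).le]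
      exact Real.exp_le_exp.2 ((le_abs_self _).trans (hC ω)))
  have := isProbabilityMeasure_tilted hexp
  have h1 := InformationTheory.integral_llr_add_sub_measure_univ_nonneg
    (hac.trans (absolutelyContinuous_tilted hexp))
    (integrable_llr_tilted_right hac hYQ hint hexp)
  rw [integral_llr_tilted_right hac hYQ hexp hint] at h1
  rw [InformationTheory.toReal_klDiv_of_measure_eq hac (by simp)]
  simp only [probReal_univ] at h1
  linarith

/-- The minimizer `√a / √b` is unavailable when `a` or `b` vanishes. Adding a small `δ` to both
roots keeps `r` positive at an arbitrarily small cost, which the strict inequality leaves room for.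
-/
theorem exists_div_add_mul_le {a b x : ℝ} (ha : 0 ≤ a) (hb : 0 ≤ b) (hx : 2 * √(a * b) < x) :
    ∃ r > 0, a / r + b * r ≤ x := by
  set ε := x - 2 * √(a * b) with hε
  have hε0 : 0 < ε := sub_pos.2 hx
  set δ := ε / (√a + √b + 1) with hδ
  have hδ0 : 0 < δ := by positivity
  have hδε : δ * (√a + √b) ≤ ε := by
    have : δ * (√a + √b + 1) = ε := by rw [hδ]; field_simp
    linarith
  have h1 : 0 < √a + δ := by positivity
  have h2 : 0 < √b + δ := by positivity
  have h3 : a / ((√a + δ) / (√b + δ)) ≤ √a * (√b + δ) := by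
    rw [div_div_eq_mul_div, div_le_iff₀ h1]
    nlinarith [Real.mul_self_sqrt ha, Real.sqrt_nonneg a, mul_nonneg (Real.sqrt_nonneg a) h2.le]
  have h4 : b * ((√a + δ) / (√b + δ)) ≤ √b * (√a + δ) := by
    rw [← mul_div_assoc, div_le_iff₀ h2]
    nlinarith [Real.mul_self_sqrt hb, Real.sqrt_nonneg b, mul_nonneg (Real.sqrt_nonneg b) h1.le]
  refine ⟨(√a + δ) / (√b + δ), by positivity, ?_⟩
  have h5 : √(a * b) = √a * √b := Real.sqrt_mul ha b
  rw [h5] at hε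
  linarith

/-! ### Centering, multiplication and the essential supremum -/

section Variance

variable {S : Type*} [MeasurableSpace S] {μ : Measure S} [IsProbabilityMeasure μ]

theorem inner_const_one (g : Lp ℝ 2 μ) : ⟪Lp.const 2 μ (1 : ℝ), g⟫ = ∫ x, g x ∂μ := by
  rw [L2.inner_def]
  refine integral_congr_ae ?_
  filter_upwards [Lp.coeFn_const 2 μ (1 : ℝ)] with x hx
  rw [hx]
  simp

theorem norm_const_one : ‖Lp.const 2 μ (1 : ℝ)‖ = 1 := by
  rw [norm_eq_sqrt_real_inner, inner_const_one,
    integral_congr_ae (Lp.coeFn_const 2 μ (1 : ℝ))]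
  simp

theorem Poincare.norm_sq_le {A : Lp ℝ 2 μ →ₗ.[ℝ] Lp ℝ 2 μ} {α : ℝ} (h : Poincare A α)
    (g : A.domain) (hg : ⟪Lp.const 2 μ (1 : ℝ), (g : Lp ℝ 2 μ)⟫ = 0) :
    ‖(g : Lp ℝ 2 μ)‖ ^ 2 ≤ -α * ⟪A g, (g : Lp ℝ 2 μ)⟫ := by
  refine le_trans (le_of_eq ?_) (h g)
  rw [inner_const_one] at hg
  rw [variance_of_integral_eq_zero (Lp.memLp _).1.aemeasurable hg, ← real_inner_self_eq_norm_sq,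
    L2.inner_def]
  refine integral_congr_ae (ae_of_all _ fun x => ?_)
  simp [sq]

theorem integral_center (g : Lp ℝ 2 μ) : ∫ x, center g x ∂μ = 0 := by
  have h1 : Integrable g μ := (Lp.memLp g).integrable (by norm_num)
  rw [center, integral_congr_ae (Lp.coeFn_sub _ _), integral_sub' h1
    ((Lp.memLp _).integrable (by norm_num)), integral_congr_ae (Lp.coeFn_const 2 μ _)]
  simp

theorem coeFn_center_toLp {f : S → ℝ} (hf : MemLp f 2 μ) :
    center (hf.toLp f) =ᵐ[μ] fun x => f x - ∫ y, f y ∂μ := by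
  rw [center]
  filter_upwards [Lp.coeFn_sub (hf.toLp f) (Lp.const 2 μ (∫ x, (hf.toLp f) x ∂μ)),
    hf.coeFn_toLp, Lp.coeFn_const 2 μ (∫ x, (hf.toLp f) x ∂μ)] with x h1 h2 h3
  rw [h1, Pi.sub_apply, h2, h3, Function.const_apply, integral_congr_ae hf.coeFn_toLp]

omit [IsProbabilityMeasure μ] in
theorem inner_mulOp_le {V : S → ℝ} {C m : ℝ} (hV : Measurable V) (hb : ∀ x, |V x| ≤ C)
    (hm : ∀ᵐ x ∂μ, V x ≤ m) (g : Lp ℝ 2 μ) : ⟪mulOp μ hV hb g, g⟫ ≤ m * ‖g‖ ^ 2 := by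
  rw [← real_inner_self_eq_norm_sq, L2.inner_def, L2.inner_def, ← integral_const_mul]
  refine integral_mono_ae (L2.integrable_inner _ _) ((L2.integrable_inner _ _).const_mul _) ?_
  filter_upwards [hm, coeFn_mulOp hV hb g] with x h1 h2
  rw [h2]
  simp only [RCLike.inner_apply, conj_trivial]
  nlinarith [mul_self_nonneg (g x)]

theorem ae_le_supNormPart {f : S → ℝ} {C : ℝ} (hf : Measurable f)
    (hC : ∀ x, |f x| ≤ C) (s : ℝ) :
    ∀ᵐ x ∂μ, s * (f x - ∫ y, f y ∂μ) ≤ supNormPart s f μ := by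
  set F : S → ℝ := fun x => max (s * (f x - ∫ y, f y ∂μ)) 0 with hF
  have hFm : Measurable F := ((hf.sub_const _).const_mul s).max measurable_const
  have hFb : ∀ x, ‖F x‖ ≤ |s| * (C + |∫ y, f y ∂μ|) := fun x => by
    rw [Real.norm_of_nonneg (le_max_right _ _)]
    have h1 : |s * (f x - ∫ y, f y ∂μ)| ≤ |s| * (C + |∫ y, f y ∂μ|) := by
      rw [abs_mul]
      gcongr
      exact (abs_sub _ _).trans (by gcongr; exact hC x)
    exact max_le ((le_abs_self _).trans h1) ((abs_nonneg _).trans h1)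
  have hfin : eLpNorm F ∞ μ ≠ ∞ :=
    (MemLp.of_bound (p := ∞) hFm.aestronglyMeasurable _ (ae_of_all _ hFb)).2.ne
  have hae : ∀ᵐ x ∂μ, ‖F x‖ₑ ≤ eLpNorm F ∞ μ := by
    rw [eLpNorm_exponent_top]
    exact enorm_ae_le_eLpNormEssSup F μ
  filter_upwards [hae] with x hx
  have h1 := ENNReal.toReal_mono hfin hx
  rw [toReal_enorm, Real.norm_of_nonneg (le_max_right _ _)] at h1
  exact (le_max_left _ _).trans h1

end Variance

/-! ### Finiteness of the spectral bound -/

section Kappa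

variable {S : Type*} [MeasurableSpace S] {p : ℝ≥0 → Kernel S S} [∀ t, IsMarkovKernel (p t)]
  {μ : Measure S} [IsProbabilityMeasure μ] {hμ : ∀ t, (p t).Invariant μ}

/-- `κ(V)` is finite for bounded `V`. -/
theorem exists_kappa_eq_coe (hQ : IsContractionSemigroup (semigroup p μ hμ)) {V : S → ℝ} {C : ℝ}
    (hV : Measurable V) (hb : ∀ x, |V x| ≤ C) :
    ∃ κ : ℝ, kappa (generator (semigroup p μ hμ)) V = κ := by
  -- The constant function `1` is a unit vector of the domain, so the supremum is not over an empty
  -- set.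
  obtain ⟨k, hk, -⟩ := IsContractionSemigroup.generator_eq_zero
    (fun t => semigroup_const μ hμ t (1 : ℝ))
  have hk1 : ‖(k : Lp ℝ 2 μ)‖ = 1 := by rw [hk, norm_const_one]
  have hbot : kappa (generator (semigroup p μ hμ)) V ≠ ⊥ := by
    have h1 := le_iSup₂ (f := fun (g : (generator (semigroup p μ hμ)).domain)
      (_ : ‖(g : Lp ℝ 2 μ)‖ = 1) =>
        ((⟪generator (semigroup p μ hμ) g, (g : Lp ℝ 2 μ)⟫
          + ∫ x, V x * ((g : Lp ℝ 2 μ) x) ^ 2 ∂μ : ℝ) : EReal)) k hk1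
    exact ne_bot_of_le_ne_bot (EReal.coe_ne_bot _) h1
  have htop : kappa (generator (semigroup p μ hμ)) V ≠ ⊤ := by
    refine ne_top_of_le_ne_top (EReal.coe_ne_top C) (iSup₂_le fun g hg => ?_)
    rw [EReal.coe_le_coe_iff, ← inner_mulOp_self hV hb]
    have h1 := hQ.inner_generator_nonpos g
    have h2 := inner_mulOp_le hV hb (ae_of_all μ fun x => (le_abs_self _).trans (hb x))
      (g : Lp ℝ 2 μ)
    rw [hg, one_pow, mul_one] at h2
    linarith
  exact ⟨_, (EReal.coe_toReal htop hbot).symm⟩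

omit [IsProbabilityMeasure μ] in
theorem le_of_kappa_eq {A : Lp ℝ 2 μ →ₗ.[ℝ] Lp ℝ 2 μ} {V : S → ℝ} {κ : ℝ} (h : kappa A V = κ)
    (g : A.domain) (hg : ‖(g : Lp ℝ 2 μ)‖ = 1) :
    ⟪A g, (g : Lp ℝ 2 μ)⟫ + ∫ x, V x * ((g : Lp ℝ 2 μ) x) ^ 2 ∂μ ≤ κ := by
  have h1 := le_iSup₂ (f := fun (g : A.domain) (_ : ‖(g : Lp ℝ 2 μ)‖ = 1) =>
    ((⟪A g, (g : Lp ℝ 2 μ)⟫ + ∫ x, V x * ((g : Lp ℝ 2 μ) x) ^ 2 ∂μ : ℝ) : EReal)) g hg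
  change _ ≤ kappa A V at h1
  rw [h] at h1
  exact EReal.coe_le_coe_iff.1 h1

end Kappa

/-! ### Path integrals under a change of measure -/

section Bounds

variable {S Ω : Type*} [TopologicalSpace S] [PolishSpace S] [MeasurableSpace S] [BorelSpace S]
  {mΩ : MeasurableSpace Ω} {𝓕 : Filtration ℝ≥0 mΩ}
  {X : ℝ≥0 → Ω → S} {p : ℝ≥0 → Kernel S S} {μ : Measure S} {ρ : Measure Ω}
  [IsProbabilityMeasure ρ] {V : S → ℝ} {C : ℝ} [∀ t, IsMarkovKernel (p t)]
  [IsProbabilityMeasure μ] {hμ : ∀ t, (p t).Invariant μ}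

/-- The bound on path integrals under a measure `Q` of finite entropy relative to the stationary
Markov measure `ρ`. -/
theorem IsStationaryMarkov.integral_pathIntegral_le (h : IsStationaryMarkov 𝓕 X p μ ρ)
    (hQ : IsContractionSemigroup (semigroup p μ hμ))
    (hsa : IsSelfAdjoint (generator (semigroup p μ hμ)))
    (hc : ∀ ω t, ContinuousWithinAt (fun s => X s ω) (Set.Ici t) t) (hV : Measurable V)
    (hb : ∀ x, |V x| ≤ C) {κ : ℝ} (hκ : kappa (generator (semigroup p μ hμ)) V = κ)
    (Q : Measure Ω) [IsProbabilityMeasure Q] (T : ℝ≥0)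
    (hfin : InformationTheory.klDiv (Q.trim (𝓕.le T)) (ρ.trim (𝓕.le T)) ≠ ∞) :
    ∫ ω, pathIntegral V X T ω ∂Q
      ≤ (InformationTheory.klDiv (Q.trim (𝓕.le T)) (ρ.trim (𝓕.le T))).toReal + κ * T := by
  have hm : Measurable[𝓕 T] (pathIntegral V X T) := by
    have := measurable_pathIntegral_filtration h.measurable hc hV (t := T) T.2
    rwa [Real.toNNReal_coe] at this
  have : IsProbabilityMeasure (Q.trim (𝓕.le T)) := ⟨by simp [trim_measurableSet_eq]⟩
  have : IsProbabilityMeasure (ρ.trim (𝓕.le T)) := ⟨by simp [trim_measurableSet_eq]⟩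
  -- The variational principle is used on the σ-algebra `𝓕 T` with both measures restricted to it.
  -- The path integral is `𝓕 T`-measurable, so its integrals are unaffected by the restriction.
  have h1 := @integral_le_klDiv_add_log Ω (𝓕 T) (Q.trim (𝓕.le T)) (ρ.trim (𝓕.le T)) _ _ _ hm _
    (fun ω => abs_pathIntegral_le hb ω T) hfin
  rw [← integral_trim (𝓕.le T) hm.stronglyMeasurable, ← integral_trim (𝓕.le T)
    (@Measurable.exp Ω (𝓕 T) _ hm).stronglyMeasurable] at h1
  refine h1.trans (add_le_add_right ?_ _)
  have h2 := h.integral_exp_pathIntegral_le hQ hsa hc hV hb (le_of_kappa_eq hκ) T.2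
  have h3 : 0 < ∫ ω, Real.exp (pathIntegral V X T ω) ∂ρ :=
    integral_exp_pos (Integrable.of_bound
      (measurable_pathIntegral h.measurable' hc hV T).exp.aestronglyMeasurable
      (Real.exp (C * |(T : ℝ)|)) (ae_of_all _ fun ω => by
        rw [Real.norm_of_nonneg (Real.exp_pos _).le]
        exact Real.exp_le_exp.2 ((le_abs_self _).trans (abs_pathIntegral_le hb ω T))))
  exact (Real.log_le_iff_le_exp h3).2 h2

theorem pathIntegral_const_mul_sub {X : ℝ≥0 → Ω → S} (hX : ∀ t, Measurable (X t))
    (hc : ∀ ω t, ContinuousWithinAt (fun s => X s ω) (Set.Ici t) t) {f : S → ℝ}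
    (hf : Measurable f) (hb : ∀ x, |f x| ≤ C) (a m : ℝ) {T : ℝ≥0} (hT : 0 < T) (ω : Ω) :
    pathIntegral (fun x => a * (f x - m)) X T ω = a * T * (timeAverage f X T ω - m) := by
  have hT' : (T : ℝ) ≠ 0 := by exact_mod_cast hT.ne'
  rw [pathIntegral, timeAverage, intervalIntegral.integral_const_mul, intervalIntegral.integral_sub
    (intervalIntegrable_comp hX hc hf hb ω _ _) intervalIntegrable_const,
    intervalIntegral.integral_const]
  simp only [sub_zero, smul_eq_mul]
  field_simp

end Bounds

/-! ### The sub-gamma bound -/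

section SubGamma

variable {S : Type*} [MeasurableSpace S] {p : ℝ≥0 → Kernel S S} [∀ t, IsMarkovKernel (p t)]
  {μ : Measure S} [IsProbabilityMeasure μ] {hμ : ∀ t, (p t).Invariant μ} {C : ℝ}

/-- The sub-gamma bound on `κ(s c (f - μ[f]))`. -/
theorem kappa_le (hQ : IsContractionSemigroup (semigroup p μ hμ))
    (hsa : IsSelfAdjoint (generator (semigroup p μ hμ))) {α : ℝ} (hα : 0 < α)
    (hp : Poincare (generator (semigroup p μ hμ)) α) {f : S → ℝ} (hf : Measurable f)
    (hb : ∀ x, |f x| ≤ C) (hf2 : MemLp f 2 μ) {s : ℝ} (hs : s * s = 1) {c : ℝ} (hc : 0 < c)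
    (hcm : c * (α * supNormPart s f μ) < 1) :
    kappa (generator (semigroup p μ hμ)) (fun x => s * c * (f x - ∫ y, f y ∂μ))
      ≤ ((c ^ 2 * asympVar (semigroup p μ hμ) (hf2.toLp f)
          / (2 * (1 - c * (α * supNormPart s f μ))) : ℝ) : EReal) := by
  set V : S → ℝ := fun x => s * (f x - ∫ y, f y ∂μ) with hVdef
  have hV : Measurable V := (hf.sub_const _).const_mul s
  have hVb : ∀ x, |V x| ≤ |s| * (C + |∫ y, f y ∂μ|) := fun x => by
    rw [hVdef, abs_mul]
    gcongr
    exact (abs_sub _ _).trans (by gcongr; exact hb x)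
  set e := Lp.const 2 μ (1 : ℝ) with he
  have hBe : mulOp μ hV hVb e = s • center (hf2.toLp f) := by
    refine Lp.ext ?_
    filter_upwards [coeFn_mulOp hV hVb e, Lp.coeFn_smul s (center (hf2.toLp f)),
      coeFn_center_toLp hf2, Lp.coeFn_const 2 μ (1 : ℝ)] with x h1 h2 h3 h4
    rw [h1, h2, Pi.smul_apply, h3, h4]
    simp [hVdef]
  -- The sign occurs once in each argument of the bilinear form and cancels by `s * s = 1`, so both
  -- signs share one asymptotic variance.
  have hσ : asympVar (semigroup p μ hμ) (hf2.toLp f)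
      = 2 * ⟪∫ t in Set.Ioi (0 : ℝ), semigroup p μ hμ t.toNNReal (mulOp μ hV hVb e),
        mulOp μ hV hVb e⟫ := by
    rw [asympVar, poisson, hBe]
    simp only [map_smul]
    rw [integral_smul, real_inner_smul_left, real_inner_smul_right, ← mul_assoc s s, hs, one_mul]
  refine iSup₂_le fun g hg => ?_
  rw [EReal.coe_le_coe_iff, hσ]
  have h1 := hQ.inner_generator_add_le hsa (fun t => semigroup_const μ hμ t (1 : ℝ))
    norm_const_one hα hp.norm_sq_le (inner_mulOp_comm hV hVb) (m := supNormPart s f μ)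
    ENNReal.toReal_nonneg (inner_mulOp_le hV hVb (ae_le_supNormPart hf hb s))
    (by rw [hBe, inner_smul_right, inner_const_one, integral_center, mul_zero]) hc hcm g hg
  refine le_trans (le_of_eq ?_) h1
  rw [inner_mulOp_self, ← integral_const_mul]
  congr 1
  refine integral_congr_ae (ae_of_all _ fun x => ?_)
  simp only [hVdef]
  ring

end SubGamma

end MarkovUQ

end

/-! ### The main theorem -/

theorem mainTheorem5 {𝒳 Ω : Type*} [TopologicalSpace 𝒳] [PolishSpace 𝒳] [MeasurableSpace 𝒳]
    [BorelSpace 𝒳] {mΩ : MeasurableSpace Ω} (𝓕 : Filtration ℝ≥0 mΩ) (X : ℝ≥0 → Ω → 𝒳)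
    (p : ℝ≥0 → Kernel 𝒳 𝒳) [∀ t, IsMarkovKernel (p t)] (P P' : 𝒳 → Measure Ω)
    (hP : MarkovUQ.IsMarkovFamily 𝓕 X p P) (hP' : MarkovUQ.IsStartedFamily X P')
    (μ : Measure 𝒳) [IsProbabilityMeasure μ] (hμ : ∀ t, (p t).Invariant μ)
    (hsa : IsSelfAdjoint (MarkovUQ.generator (MarkovUQ.semigroup p μ hμ)))
    (α : ℝ) (hα : 0 < α)
    (hpoin : MarkovUQ.Poincare (MarkovUQ.generator (MarkovUQ.semigroup p μ hμ)) α)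
    (f : 𝒳 → ℝ) (hf : Measurable f) (hfb : ∃ C, ∀ x, |f x| ≤ C)
    (ν : Measure 𝒳) [IsProbabilityMeasure ν] (T : ℝ≥0) (hT : 0 < T) :
    let A := MarkovUQ.generator (MarkovUQ.semigroup p μ hμ)
    let fL : Lp ℝ 2 μ := (MarkovUQ.memLp_of_bdd hf hfb).toLp f
    let Pμ : Measure Ω := MarkovUQ.mixture P hP.universallyMeasurable μ
    let Pν' : Measure Ω := MarkovUQ.mixture P' hP'.universallyMeasurable ν
    let η : ℝ≥0∞ := MarkovUQ.entropyRate 𝓕 T Pν' Pμ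
    let σsq : ℝ := MarkovUQ.asympVar (MarkovUQ.semigroup p μ hμ) fL
    let Λ : ℝ → EReal := fun c => MarkovUQ.kappa A fun x => c * (f x - ∫ y, f y ∂μ)
    -- the integral that defines the Poisson operator at `f - μ[f]` converges absolutely
    IntegrableOn (fun t : ℝ => MarkovUQ.semigroup p μ hμ t.toNNReal (MarkovUQ.center fL))
      (Set.Ioi 0) ∧
    ∀ s ∈ ({1, -1} : Set ℝ),
      ((s * ((∫ ω, MarkovUQ.timeAverage f X T ω ∂Pν') - ∫ x, f x ∂μ) : ℝ) : EReal)
          ≤ MarkovUQ.Xi s Λ η ∧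
      (η ≠ ∞ → MarkovUQ.Xi s Λ η
          ≤ ((√(2 * σsq * η.toReal) + α * MarkovUQ.supNormPart s f μ * η.toReal : ℝ) : EReal)) := by
  intro A fL Pμ Pν' η σsq Λ
  have hfL : MemLp f 2 μ := MarkovUQ.memLp_of_bdd hf hfb
  have hQ := hP.isContractionSemigroup μ hμ hsa.dense_domain
  have hc : ∀ ω t, ContinuousWithinAt (fun s => X s ω) (Set.Ici t) t := fun ω t =>
    (hP.cadlag ω t).1
  have hst : MarkovUQ.IsStationaryMarkov 𝓕 X p μ Pμ := hP.isStationaryMarkov μ hμ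
  have hPμ : IsProbabilityMeasure Pμ := hst.isProbabilityMeasure
  have hPν : IsProbabilityMeasure Pν' :=
    MarkovUQ.isProbabilityMeasure_mixture _ ν hP'.isProbabilityMeasure
  obtain ⟨C, hC⟩ := hfb
  have hint : IntegrableOn (fun t : ℝ => MarkovUQ.semigroup p μ hμ t.toNNReal
      (MarkovUQ.center fL)) (Set.Ioi 0) :=
    hQ.integrableOn_apply hsa (fun t => MarkovUQ.semigroup_const μ hμ t (1 : ℝ)) hα
      hpoin.norm_sq_le (by rw [MarkovUQ.inner_const_one, MarkovUQ.integral_center])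
  have hT0 : (0 : ℝ) < T := hT
  refine ⟨hint, fun s hs => ⟨?_, fun hη => ?_⟩⟩
  · refine le_iInf₂ fun c hc0 => ?_
    have hVm : Measurable fun x => s * c * (f x - ∫ y, f y ∂μ) := (hf.sub_const _).const_mul _
    have hVb : ∀ x, |s * c * (f x - ∫ y, f y ∂μ)| ≤ |s * c| * (C + |∫ y, f y ∂μ|) := fun x => by
      rw [abs_mul]
      gcongr
      exact (abs_sub _ _).trans (by gcongr; exact hC x)
    obtain ⟨κ, hκ⟩ := MarkovUQ.exists_kappa_eq_coe hQ hVm hVb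
    change _ ≤ (MarkovUQ.kappa A (fun x => s * c * (f x - ∫ y, f y ∂μ)) + (η : EReal)) / (c : EReal)
    rw [hκ]
    by_cases hη : η = ∞
    · rw [hη, EReal.coe_ennreal_top, EReal.coe_add_top,
        EReal.top_div_of_pos_ne_top (by exact_mod_cast hc0) (EReal.coe_ne_top c)]
      exact le_top
    · have hkl : InformationTheory.klDiv (Pν'.trim (𝓕.le T)) (Pμ.trim (𝓕.le T)) ≠ ∞ := by
        intro h
        exact hη (by
          change InformationTheory.klDiv _ _ / (T : ℝ≥0∞) = ∞
          rw [h, ENNReal.top_div_coe])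
      have hηr : η.toReal
          = (InformationTheory.klDiv (Pν'.trim (𝓕.le T)) (Pμ.trim (𝓕.le T))).toReal / T := by
        change (InformationTheory.klDiv _ _ / (T : ℝ≥0∞)).toReal = _
        rw [ENNReal.toReal_div, ENNReal.coe_toReal]
      rw [← EReal.coe_ennreal_toReal hη, ← EReal.coe_add, ← EReal.coe_div, EReal.coe_le_coe_iff,
        hηr, le_div_iff₀ hc0]
      -- For this potential the path integral is `s * c * T` times the deviation of the time
      -- average, so the claim is this bound divided by `c * T`.
      have h1 := hst.integral_pathIntegral_le hQ hsa hc hVm hVb hκ Pν' T hkl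
      simp only [MarkovUQ.pathIntegral_const_mul_sub hst.measurable' hc hf hC (s * c)
        (∫ y, f y ∂μ) hT] at h1
      have hav : Integrable (MarkovUQ.timeAverage f X T) Pν' := by
        refine Integrable.of_bound ((MarkovUQ.measurable_pathIntegral hst.measurable' hc hf
          T).const_mul _).aestronglyMeasurable ((T : ℝ)⁻¹ * (C * |(T : ℝ)|))
          (ae_of_all _ fun ω => ?_)
        rw [MarkovUQ.timeAverage, norm_mul, Real.norm_of_nonneg (inv_nonneg.2 hT0.le)]
        gcongr
        exact MarkovUQ.abs_pathIntegral_le hC ω T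
      rw [integral_const_mul, integral_sub hav (integrable_const _), integral_const,
        probReal_univ, one_smul] at h1
      rw [← mul_le_mul_iff_left₀ hT0]
      refine le_trans (le_of_eq (by ring)) (h1.trans_eq ?_)
      field_simp
      ring
  · have hss : s * s = 1 := by
      rcases hs with rfl | rfl <;> norm_num
    set M := α * MarkovUQ.supNormPart s f μ with hM
    have hM0 : 0 ≤ M := mul_nonneg hα.le ENNReal.toReal_nonneg
    -- Half of `σsq` is the energy `-⟪A l, l⟫` of the Poisson solution `l`.
    have hσ0 : 0 ≤ σsq := by
      obtain ⟨l, hl, hAl⟩ := hQ.exists_generator_poisson hint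
      have h1 := hQ.inner_generator_nonpos l
      rw [hAl, hl, inner_neg_left, real_inner_comm] at h1
      change 0 ≤ 2 * ⟪∫ t in Set.Ioi (0 : ℝ), _, MarkovUQ.center fL⟫
      linarith
    refine EReal.le_of_forall_lt_iff_le.1 fun z hz => ?_
    rw [EReal.coe_lt_coe_iff] at hz
    -- The choice `c = 1 / (M + r)` gives `1 - c * M = r / (M + r)`, so the constraint `c * M < 1`
    -- becomes `r > 0` and the objective is bounded by `σsq / (2 * r) + η * r + M * η`. The infimum
    -- over `r` need not be attained, hence the slack up to `z`.
    obtain ⟨r, hr, hrz⟩ := MarkovUQ.exists_div_add_mul_le (a := σsq / 2) (b := η.toReal)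
      (x := z - M * η.toReal) (div_nonneg hσ0 zero_le_two) ENNReal.toReal_nonneg (by
        have h1 : 2 * √(σsq / 2 * η.toReal) = √(2 * σsq * η.toReal) := by
          rw [show 2 * σsq * η.toReal = 2 ^ 2 * (σsq / 2 * η.toReal) by ring,
            Real.sqrt_mul (sq_nonneg (2 : ℝ)), Real.sqrt_sq zero_le_two]
        linarith)
    have hMr : 0 < M + r := by positivity
    have hc0 : 0 < 1 / (M + r) := by positivity
    have hd : 1 - 1 / (M + r) * M = r / (M + r) := by field_simp; ring
    have hΛ := MarkovUQ.kappa_le hQ hsa hα hpoin hf hC hfL hss hc0 (by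
      rw [← hM, ← sub_pos, hd]
      positivity)
    refine (iInf₂_le (1 / (M + r)) hc0).trans ?_
    change (MarkovUQ.kappa A (fun x => s * (1 / (M + r)) * (f x - ∫ y, f y ∂μ)) + (η : EReal))
      / ((1 / (M + r) : ℝ) : EReal) ≤ z
    rw [EReal.div_le_iff_le_mul (by exact_mod_cast hc0) (EReal.coe_ne_top _),
      ← EReal.coe_ennreal_toReal hη]
    refine (add_le_add_left hΛ _).trans ?_
    rw [← EReal.coe_add, ← EReal.coe_mul, EReal.coe_le_coe_iff, ← hM, hd]
    change (1 / (M + r)) ^ 2 * σsq / (2 * (r / (M + r))) + η.toReal ≤ _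
    calc (1 / (M + r)) ^ 2 * σsq / (2 * (r / (M + r))) + η.toReal
        = 1 / (M + r) * (σsq / 2 / r + η.toReal * r + M * η.toReal) := by
          field_simp
          ring
      _ ≤ 1 / (M + r) * z := by gcongr; linarith
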